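/- For $\alpha,\lambda\in(0,\infty)$ and $\beta\in[0,1)$ let ${\rm TS}(\alpha,\beta,\lambda)$ denote the infinitely divisible distribution on $\mathbb{R}$ with characteristic function $$z\mapsto\exp\Big(\int_0^\infty (e^{izx}-1)\,\frac{\alpha}{x^{1+\beta}}e^{-\lambda x}\,dx\Big),\quad z\in\mathbb{R}.$$ For $\alpha^\pm,\lambda^\pm\in(0,\infty)$ and $\beta^\pm\in[0,1)$ let ${\rm TS}(\alpha^+,\beta^+,\lambda^+;\alpha^-,\beta^-,\lambda^-)$ be the convolution of ${\rm TS}(\alpha^+,\beta^+,\lambda^+)$ with the image of ${\rm TS}(\alpha^-,\beta^-,\lambda^-)$ under $x\mapsto -x$. Let $G_Z$ denote the distribution function of a random variable $Z$, and $\Phi_{\mu,\sigma^2}$ that of the normal distribution $N(\mu,\sigma^2)$. Let $c$ be the Berry–Esseen constant, that is, the least real number $C$ such that for all $n\in\mathbb{N}=\{1,2,\dots\}$ and all i.i.d. real random variables $Y_1,\dots,Y_n$ with $\mathbb{E}|Y_1|^3<\infty$, mean $m$ and variance $s^2>0$ (with $s>0$), $$\sup_{x\in\mathbb{R}}\big|G_{(Y_1+\cdots+Y_n-nm)/(s\sqrt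 n)}(x)-\Phi_{0,1}(x)\big|\le C\,\frac{\mathbb{E}|Y_1-m|^3}{s^3\sqrt n};$$ such a least constant exists. **Theorem.** Let $\alpha^\pm,\lambda^\pm\in(0,\infty)$, $\beta^\pm\in[0,1)$, and let $X\sim{\rm TS}(\alpha^+,\beta^+,\lambda^+;\alpha^-,\beta^-,\lambda^-)$ be a random variable. Then $X$ is square integrable with positive variance, and with $\mu:=\mathbb{E}[X]$, $\sigma^2:={\rm Var}[X]$, $\sigma>0$, we have $$\begin{aligned}\sup_{x\in\mathbb{R}}|G_X(x)-\Phi_{\mu,\sigma^2}(x)|\le 32c\bigg[&(1-\beta^+)(2-\beta^+)\frac{(1-\beta^-)\mu/\sigma^3+\lambda^- /\sigma}{\lambda^+\big((1-\beta^-)\lambda^++(1-\beta^+)\lambda^-\big)}\\&+(1-\beta^-)(2-\beta^-)\frac{(\beta^+-1)\mu/\sigma^3+\lambda^+/\sigma}{\lambda^-\big((1-\beta^-)\lambda^++(1-\beta^+)\lambda^-\big)}\bigg].\end{aligned}$$ -/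

import Mathlib

open MeasureTheory ProbabilityTheory

noncomputable section

/-- The law of `Y₁ + ⋯ + Yₙ` for i.i.d. real random variables `Yᵢ` with law `ν`
(the `n`-fold convolution power of `ν`). -/
def iidSumLaw (ν : Measure ℝ) (n : ℕ) : Measure ℝ :=
  (Measure.pi (fun _ : Fin n => ν)).map (fun y => ∑ i, y i)

/-- Infinite divisibility of a probability distribution on `ℝ`: it has an `n`-th convolution root
for every `n ≥ 1`. -/
def IsInfinitelyDivisible (η : Measure ℝ) : Prop :=
  ∀ n : ℕ, 1 ≤ n → ∃ ν : Measure ℝ, IsProbabilityMeasure ν ∧ iidSumLaw ν n = η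

/-- The Lévy measure `α x^(-1-β) e^(-lam x) 1_{(0,∞)}(x) dx`. -/
def tsLevyMeasure (α β lam : ℝ) : Measure ℝ :=
  (volume.restrict (Set.Ioi (0 : ℝ))).withDensity
    (fun x => ENNReal.ofReal (α / x ^ (1 + β) * Real.exp (-lam * x)))

/-- `η` is the one-sided tempered stable distribution `TS(α, β, lam)`: the infinitely divisible
distribution with characteristic function `z ↦ exp (∫ (e^{izx} - 1) F(dx))`, where `F` is the
Lévy measure above. -/
structure IsOneSidedTS (α β lam : ℝ) (η : Measure ℝ) : Prop where
  isProbabilityMeasure : IsProbabilityMeasure η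
  isInfinitelyDivisible : IsInfinitelyDivisible η
  charFun_eq : ∀ z : ℝ, charFun η z =
    Complex.exp (∫ x : ℝ, (Complex.exp (Complex.I * z * x) - 1) ∂(tsLevyMeasure α β lam))

/-- `η` is the (two-sided) tempered stable distribution `TS(αp, βp, lp; αm, βm, lm)`: the
convolution of `TS(αp, βp, lp)` with the reflection of `TS(αm, βm, lm)` at the origin. -/
def IsTS (αp βp lp αm βm lm : ℝ) (η : Measure ℝ) : Prop :=
  ∃ ηp ν : Measure ℝ, IsOneSidedTS αp βp lp ηp ∧ IsOneSidedTS αm βm lm ν ∧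
    η = ηp.conv (ν.map (fun x => -x))

/-- `C` is admissible in the Berry–Esseen theorem for i.i.d. sequences: for every law `ν` on `ℝ`
with finite third absolute moment and positive variance `σ²`, every `n ≥ 1` and every `x`, the
distribution function of `(Sₙ - n m) / (σ √n)`, where `Sₙ` is the sum of `n` i.i.d. variables with
law `ν` and mean `m`, differs from the standard normal one at `x` by at most
`C E|Y - m|³ / (σ³ √n)`. -/
def IsBerryEsseenBound (C : ℝ) : Prop :=
  ∀ ν : Measure ℝ, IsProbabilityMeasure ν → MemLp id 3 ν →
    ∀ m σ : ℝ, m = ∫ y, y ∂ν → σ = √(Var[id; ν]) → 0 < σ →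
    ∀ n : ℕ, 1 ≤ n → ∀ x : ℝ,
      |cdf ((iidSumLaw ν n).map (fun s => (s - n * m) / (σ * √(n : ℝ)))) x
          - cdf (gaussianReal 0 1) x|
        ≤ C * (∫ y, |y - m| ^ 3 ∂ν) / (σ ^ 3 * √(n : ℝ))

end

/-!
Two facts combine: the Berry–Esseen theorem, which gives the constant `c`, and the moments of the
`n`-th convolution roots of a tempered stable law.

**Berry–Esseen.** The admissible constants form a closed set bounded below by `0`, so it is enough
to find one (`exists_isBerryEsseenBound`). This uses Bergström's convolution method and no Fourier
analysis. The `n`-fold convolution power of a standardised law `μ` is changed into the Gaussian law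
of variance `n` by replacing one factor at a time, after smoothing with a Gaussian law of variance
`M`. As the first two moments of `μ` and of the standard Gaussian law agree, a Taylor expansion of
Gaussian convolutions (`exists_abs_integral_conv_sub_le`) bounds each replacement by `ρ / √v ^ 3`
times the size of the function integrated, with `ρ = ∫ |y| ^ 3 dμ` and `v` the variance of the
Gaussian factors present. Comparing the factors not yet replaced with a Gaussian law produces the
distance `δ k` at an earlier time `k` (`exists_replacement_bound`). Together with a smoothing
inequality (`exists_kolmogorov_smoothing`), and for `√M` a large multiple of `ρ`, the recursive
terms contribute at most half of the bound `C ρ / √n`, which is therefore propagated by induction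
(`exists_berryEsseen_standardized`).

**Moments of convolution roots.** Let `F` be a Lévy measure on `(0, ∞)` with finite first moment,
and let `ν` satisfy `charFun ν ^ n = exp Ψ`, where `Ψ z = ∫ (e^{izx} - 1) F(dx)`. Then
`‖charFun ν z‖ ^ 2 ≥ 1 - C z ^ 2`, so `ν` is square integrable, and differentiating gives the
size-bias identity `n x ν(dx) = ν ∗ (x F(dx))` (`nonneg_and_withDensity_eq_conv`). It shows that
`ν` lives on `[0, ∞)` and yields its moments recursively (`moments_of_charFun_pow_eq`). No continuous
branch of the logarithm of `charFun ν` is needed.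

**Conclusion.** A two-sided tempered stable law with mean `μ` and variance `σ²` has the `n`-th root
`ζ n = ν⁺ ∗ (reflected ν⁻)`, and `n ∫ |y - μ / n| ^ 3 ζ n (dy)` is at most four times
`∫ x ^ 3 F⁺(dx) + ∫ x ^ 3 F⁻(dx)` up to an error of order `1 / n`. The Berry–Esseen bound for the
`n` summands and `n → ∞` give the estimate with `4 c` in place of `32 c`
(`normal_approximation_of_isOneSidedTS`). Finally the bracket in the theorem is the sum of these two
third moments divided by `σ ^ 3` (`third_moment_eq_bracket`), as the functional equation of the Gamma
function relates consecutive moments of the Lévy measure (`integral_pow_succ_tsLevyMeasure`).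
-/

/-! ### Laws of sums and their distribution functions -/

instance isProbabilityMeasure_iidSumLaw (ν : Measure ℝ) [IsProbabilityMeasure ν] (n : ℕ) :
    IsProbabilityMeasure (iidSumLaw ν n) :=
  Measure.isProbabilityMeasure_map (by fun_prop)

theorem charFun_iidSumLaw (ν : Measure ℝ) [IsProbabilityMeasure ν] (n : ℕ) (t : ℝ) :
    charFun (iidSumLaw ν n) t = charFun ν t ^ n := by
  rw [charFun_apply_real, iidSumLaw, integral_map (by fun_prop) (by fun_prop)]
  have h : ∀ y : Fin n → ℝ, Complex.exp (t * ((∑ i, y i : ℝ) : ℂ) * Complex.I)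
      = ∏ i, Complex.exp (t * (y i : ℂ) * Complex.I) := fun y => by
    rw [← Complex.exp_sum]; push_cast; rw [Finset.mul_sum, Finset.sum_mul]
  simp_rw [h]
  rw [integral_fintype_prod_eq_prod (fun _ : Fin n => fun y : ℝ => Complex.exp (t * y * Complex.I))]
  simp [charFun_apply_real]

theorem iidSumLaw_zero (ν : Measure ℝ) [IsProbabilityMeasure ν] :
    iidSumLaw ν 0 = Measure.dirac 0 := by
  apply Measure.ext_of_charFun
  ext t
  simp [charFun_iidSumLaw]

theorem iidSumLaw_one (ν : Measure ℝ) [IsProbabilityMeasure ν] : iidSumLaw ν 1 = ν := by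
  apply Measure.ext_of_charFun
  ext t
  simp [charFun_iidSumLaw]

theorem iidSumLaw_succ (ν : Measure ℝ) [IsProbabilityMeasure ν] (n : ℕ) :
    iidSumLaw ν (n + 1) = iidSumLaw ν n ∗ ν := by
  apply Measure.ext_of_charFun
  ext t
  simp [charFun_iidSumLaw, charFun_conv, pow_succ]

theorem iidSumLaw_conv (ν ξ : Measure ℝ) [IsProbabilityMeasure ν] [IsProbabilityMeasure ξ] (n : ℕ) :
    iidSumLaw (ν ∗ ξ) n = iidSumLaw ν n ∗ iidSumLaw ξ n := by
  apply Measure.ext_of_charFun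
  ext t
  simp [charFun_iidSumLaw, charFun_conv, mul_pow]

theorem charFun_map_neg_real (ν : Measure ℝ) (t : ℝ) :
    charFun (ν.map (fun x => -x)) t = charFun ν (-t) := by
  have := charFun_map_mul (μ := ν) (-1) t
  simpa using this

theorem iidSumLaw_map_neg (ν : Measure ℝ) [IsProbabilityMeasure ν] (n : ℕ) :
    iidSumLaw (ν.map (fun x => -x)) n = (iidSumLaw ν n).map (fun x => -x) := by
  have : IsProbabilityMeasure (ν.map (fun x => -x)) :=
    Measure.isProbabilityMeasure_map (by fun_prop)
  apply Measure.ext_of_charFun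
  ext t
  simp [charFun_iidSumLaw, charFun_map_neg_real]

theorem charFun_map_div_sub (ν : Measure ℝ) (m s t : ℝ) :
    charFun (ν.map (fun y => (y - m) / s)) t
      = charFun ν (t / s) * Complex.exp (-(t * m / s) * Complex.I) := by
  simp only [charFun_apply_real]
  rw [integral_map (by fun_prop) (by fun_prop), ← integral_mul_const]
  congr 1
  ext y
  rw [← Complex.exp_add]
  congr 1
  push_cast
  ring

/-- Normalising a sum of `n` terms amounts to centring and scaling each of them and then dividing
by `√n`. -/
theorem iidSumLaw_map_standardize (ν : Measure ℝ) [IsProbabilityMeasure ν] (m s : ℝ) (n : ℕ) :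
    (iidSumLaw ν n).map (fun x => (x - n * m) / (s * √(n : ℝ)))
      = (iidSumLaw (ν.map (fun y => (y - m) / s)) n).map (fun x => (x - 0) / √(n : ℝ)) := by
  have : IsProbabilityMeasure (ν.map (fun y => (y - m) / s)) :=
    Measure.isProbabilityMeasure_map (by fun_prop)
  have : IsProbabilityMeasure ((iidSumLaw ν n).map (fun x => (x - n * m) / (s * √(n : ℝ)))) :=
    Measure.isProbabilityMeasure_map (by fun_prop)
  have : IsProbabilityMeasure
    ((iidSumLaw (ν.map (fun y => (y - m) / s)) n).map (fun x => (x - 0) / √(n : ℝ))) :=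
    Measure.isProbabilityMeasure_map (by fun_prop)
  apply Measure.ext_of_charFun
  ext t
  rw [charFun_map_div_sub, charFun_map_div_sub, charFun_iidSumLaw, charFun_iidSumLaw,
    charFun_map_div_sub, mul_pow, ← Complex.exp_nat_mul]
  have h1 : t / (s * √(n : ℝ)) = t / √(n : ℝ) / s := by rw [div_div, mul_comm]
  rw [h1]
  have h2 : Complex.exp (-(t * ((0 : ℝ) : ℂ) / (√(n : ℝ) : ℝ)) * Complex.I) = 1 := by simp
  rw [h2, mul_one]
  congr 2
  push_cast
  ring

theorem cdf_map_div_sub (ν : Measure ℝ) [IsProbabilityMeasure ν] (m : ℝ) {s : ℝ} (hs : 0 < s)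
    (x : ℝ) : cdf (ν.map (fun y => (y - m) / s)) x = cdf ν (m + s * x) := by
  have : IsProbabilityMeasure (ν.map (fun y => (y - m) / s)) :=
    Measure.isProbabilityMeasure_map (by fun_prop)
  rw [cdf_eq_real, cdf_eq_real, measureReal_def, measureReal_def,
    Measure.map_apply (by fun_prop) measurableSet_Iic]
  congr 2
  ext y
  simp only [Set.mem_preimage, Set.mem_Iic, div_le_iff₀ hs]
  constructor <;> intro h <;> linarith

theorem measurable_cdf (ν : Measure ℝ) : Measurable (cdf ν) := (monotone_cdf ν).measurable

theorem abs_cdf_sub_le_one (μ ν : Measure ℝ) (x y : ℝ) : |cdf μ x - cdf ν y| ≤ 1 := by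
  rw [abs_le]
  constructor <;> linarith [cdf_nonneg μ x, cdf_nonneg ν y, cdf_le_one μ x, cdf_le_one ν y]

theorem integrable_of_abs_le {α : Type*} [MeasurableSpace α] (μ : Measure α) [IsFiniteMeasure μ]
    {h : α → ℝ} (hm : Measurable h) {B : ℝ} (hB : ∀ x, |h x| ≤ B) : Integrable h μ :=
  Integrable.of_bound hm.aestronglyMeasurable B (ae_of_all _ hB)

theorem integrable_cdf_sub (μ ν : Measure ℝ) [IsFiniteMeasure ν] (x : ℝ) :
    Integrable (fun t => cdf μ (x - t)) ν :=
  integrable_of_abs_le ν ((measurable_cdf μ).comp (by fun_prop)) (B := 1) fun t => by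
    rw [abs_of_nonneg (cdf_nonneg _ _)]; exact cdf_le_one _ _

theorem integral_conv_of_bounded (μ ν : Measure ℝ) [IsProbabilityMeasure μ]
    [IsProbabilityMeasure ν] {h : ℝ → ℝ} (hm : Measurable h) {B : ℝ} (hB : ∀ x, |h x| ≤ B) :
    ∫ z, h z ∂(μ ∗ ν) = ∫ x, ∫ y, h (x + y) ∂ν ∂μ :=
  integral_conv (integrable_of_abs_le _ hm hB)

theorem cdf_eq_integral_indicator (μ : Measure ℝ) [IsProbabilityMeasure μ] (x : ℝ) :
    cdf μ x = ∫ z, (Set.Iic x).indicator (fun _ => (1 : ℝ)) z ∂μ := by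
  rw [cdf_eq_real, integral_indicator_const _ measurableSet_Iic]
  simp

theorem abs_indicator_one_le (s : Set ℝ) (z : ℝ) : |s.indicator (fun _ => (1 : ℝ)) z| ≤ 1 := by
  by_cases h : z ∈ s <;> simp [h]

theorem cdf_conv (μ ν : Measure ℝ) [IsProbabilityMeasure μ] [IsProbabilityMeasure ν] (x : ℝ) :
    cdf (μ ∗ ν) x = ∫ t, cdf μ (x - t) ∂ν := by
  rw [Measure.conv_comm, cdf_eq_integral_indicator, integral_conv_of_bounded _ _
    (measurable_const.indicator measurableSet_Iic) (abs_indicator_one_le _)]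
  congr 1
  ext t
  rw [cdf_eq_integral_indicator]
  congr 1
  ext z
  simp only [Set.indicator_apply, Set.mem_Iic]
  congr 1
  exact propext ⟨fun h => by linarith, fun h => by linarith⟩

/-! ### A third-order Taylor expansion of Gaussian convolutions -/

/-- The centred Gaussian law on `ℝ` with variance `v`, indexed by a real number
(a negative `v` is read as `0`). -/
noncomputable def centeredGaussian (v : ℝ) : Measure ℝ := gaussianReal 0 v.toNNReal

instance isProbabilityMeasure_centeredGaussian (v : ℝ) :
    IsProbabilityMeasure (centeredGaussian v) := by
  unfold centeredGaussian; infer_instance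

theorem centeredGaussian_one : centeredGaussian 1 = gaussianReal 0 1 := by
  simp [centeredGaussian]

theorem centeredGaussian_conv {v w : ℝ} (hv : 0 ≤ v) (hw : 0 ≤ w) :
    centeredGaussian v ∗ centeredGaussian w = centeredGaussian (v + w) := by
  rw [centeredGaussian, centeredGaussian, gaussianReal_conv_gaussianReal, centeredGaussian,
    Real.toNNReal_add hv hw, add_zero]

theorem centeredGaussian_eq_map {v : ℝ} (hv : 0 ≤ v) :
    centeredGaussian v = (gaussianReal 0 1).map (fun w => √v * w) := by
  have := gaussianReal_map_const_mul (μ := 0) (v := 1) (√v)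
  rw [this, centeredGaussian]
  congr 1
  · simp
  · ext; simp [hv]

theorem cdf_centeredGaussian {v : ℝ} (hv : 0 < v) (x : ℝ) :
    cdf (centeredGaussian v) x = cdf (gaussianReal 0 1) (x / √v) := by
  have h := cdf_map_div_sub (centeredGaussian v) 0 (Real.sqrt_pos.2 hv) (x / √v)
  have h2 : (centeredGaussian v).map (fun y => (y - 0) / √v) = gaussianReal 0 1 := by
    rw [centeredGaussian_eq_map hv.le, Measure.map_map (by fun_prop) (by fun_prop)]
    convert Measure.map_id
    ext w
    simp [(Real.sqrt_pos.2 hv).ne']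
  rw [h2] at h
  rw [h]
  congr 1
  field_simp [(Real.sqrt_pos.2 hv).ne']
  ring

/-- If `E w 0 = 0` and the `L¹`-norms in `w` of `∂E/∂t` grow at most like `|t|^j`, then those
of `E` grow at most like `|t|^(j+1)`. -/
theorem lintegral_enorm_le_of_hasDerivAt {E e : ℝ → ℝ → ℝ} (h0 : ∀ w, E w 0 = 0)
    (hd : ∀ w t, HasDerivAt (E w) (e w t) t) (hc : Continuous fun p : ℝ × ℝ => e p.1 p.2)
    {A : ℝ} (hA : 0 ≤ A) {j : ℕ}
    (he : ∀ t, ∫⁻ w, ‖e w t‖ₑ ≤ ENNReal.ofReal (A * |t| ^ j)) (y : ℝ) :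
    ∫⁻ w, ‖E w y‖ₑ ≤ ENNReal.ofReal (A * |y| ^ (j + 1)) := by
  have h1 : ∀ w, ‖E w y‖ₑ ≤ ∫⁻ t in Set.uIoc 0 y, ‖e w t‖ₑ := fun w => by
    have hcw : Continuous (e w) := hc.comp (Continuous.prodMk_right w)
    have := intervalIntegral.integral_eq_sub_of_hasDerivAt (fun t _ => hd w t)
      (hcw.intervalIntegrable 0 y)
    rw [h0, sub_zero] at this
    rw [← this, intervalIntegral.intervalIntegral_eq_integral_uIoc, enorm_smul]
    refine le_trans ?_ (enorm_integral_le_lintegral_enorm _)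
    split_ifs <;> simp
  calc ∫⁻ w, ‖E w y‖ₑ ≤ ∫⁻ w, ∫⁻ t in Set.uIoc 0 y, ‖e w t‖ₑ := lintegral_mono h1
    _ = ∫⁻ t in Set.uIoc 0 y, ∫⁻ w, ‖e w t‖ₑ :=
        lintegral_lintegral_swap (hc.enorm.measurable.aemeasurable)
    _ ≤ ∫⁻ t in Set.uIoc 0 y, ENNReal.ofReal (A * |y| ^ j) := by
        refine setLIntegral_mono measurable_const fun t ht => (he t).trans ?_
        have : |t| ≤ |y| := by
          have := Set.uIoc_subset_uIcc ht
          have := Set.abs_sub_left_of_mem_uIcc this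
          simpa using this
        gcongr
    _ = ENNReal.ofReal (A * |y| ^ (j + 1)) := by
        rw [lintegral_const, Measure.restrict_apply_univ, Set.uIoc, Real.volume_Ioc,
          max_sub_min_eq_abs, sub_zero, ← ENNReal.ofReal_mul (by positivity)]
        congr 1
        ring

theorem hasDerivAt_gaussianPDFReal_zero_one (z : ℝ) :
    HasDerivAt (gaussianPDFReal 0 1) (-z * gaussianPDFReal 0 1 z) z := by
  have h : HasDerivAt (fun z : ℝ => -(z ^ 2) / 2) (-z) z := by
    have := ((hasDerivAt_pow 2 z).neg).div_const 2
    exact this.congr_deriv (by simp; ring)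
  have := (h.exp).const_mul ((√(2 * Real.pi))⁻¹)
  have e : gaussianPDFReal 0 1 = fun z => (√(2 * Real.pi))⁻¹ * Real.exp (-(z ^ 2) / 2) := by
    ext z; simp [gaussianPDFReal]
  rw [e]
  exact this.congr_deriv (by ring)

theorem integrable_abs_pow_mul_gaussianPDFReal (k : ℕ) :
    Integrable fun z : ℝ => |z| ^ k * gaussianPDFReal 0 1 z := by
  have h := (memLp_id_gaussianReal (μ := 0) (v := 1) k).integrable_norm_pow'
  rw [gaussianReal_of_var_ne_zero _ one_ne_zero,
    integrable_withDensity_iff_integrable_smul' (measurable_gaussianPDF 0 1)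
    (ae_of_all _ fun _ => gaussianPDF_lt_top)] at h
  refine h.congr (ae_of_all _ fun z => ?_)
  simp [toReal_gaussianPDF, mul_comm]

theorem integrable_mul_gaussianPDFReal_of_abs_le {f : ℝ → ℝ} (hf : Continuous f) {a : ℝ}
    (h : ∀ z, |f z| ≤ a * (1 + |z| ^ 3)) :
    Integrable fun z : ℝ => f z * gaussianPDFReal 0 1 z := by
  have h1 : Integrable fun z : ℝ => a * (|z| ^ 0 * gaussianPDFReal 0 1 z
      + |z| ^ 3 * gaussianPDFReal 0 1 z) :=
    ((integrable_abs_pow_mul_gaussianPDFReal 0).add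
      (integrable_abs_pow_mul_gaussianPDFReal 3)).const_mul a
  refine h1.mono' (hf.measurable.mul (measurable_gaussianPDFReal 0 1)).aestronglyMeasurable
    (ae_of_all _ fun z => ?_)
  rw [Real.norm_eq_abs, abs_mul, abs_of_nonneg (gaussianPDFReal_nonneg 0 1 z)]
  have := mul_le_mul_of_nonneg_right (h z) (gaussianPDFReal_nonneg 0 1 z)
  calc _ ≤ _ := this
    _ = _ := by ring

theorem abs_cubic_le (a b c d z : ℝ) :
    |a + b * z + c * z ^ 2 + d * z ^ 3| ≤ (|a| + |b| + |c| + |d|) * (1 + |z| ^ 3) := by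
  have h0 := abs_nonneg z
  have h1 : |z| ≤ 1 + |z| ^ 3 := by nlinarith [sq_nonneg (|z| - 1), sq_nonneg (|z|)]
  have h2 : |z| ^ 2 ≤ 1 + |z| ^ 3 := by nlinarith [sq_nonneg (|z| - 1), sq_nonneg (|z|)]
  have h3 : |z| ^ 3 ≤ 1 + |z| ^ 3 := by linarith
  have h4 : 1 ≤ 1 + |z| ^ 3 := by linarith [pow_nonneg h0 3]
  calc |a + b * z + c * z ^ 2 + d * z ^ 3|
      ≤ |a| + |b * z| + |c * z ^ 2| + |d * z ^ 3| := by
        refine (abs_add_le _ _).trans ?_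
        gcongr
        refine (abs_add_le _ _).trans ?_
        gcongr
        exact abs_add_le _ _
    _ = |a| * 1 + |b| * |z| + |c| * |z| ^ 2 + |d| * |z| ^ 3 := by
        simp [abs_mul, abs_pow]
    _ ≤ |a| * (1 + |z| ^ 3) + |b| * (1 + |z| ^ 3) + |c| * (1 + |z| ^ 3)
        + |d| * (1 + |z| ^ 3) := by gcongr
    _ = _ := by ring

theorem integrable_cubic_mul_gaussianPDFReal (a b c d : ℝ) :
    Integrable fun z : ℝ => (a + b * z + c * z ^ 2 + d * z ^ 3) * gaussianPDFReal 0 1 z :=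
  integrable_mul_gaussianPDFReal_of_abs_le (by fun_prop) (abs_cubic_le a b c d)

/-- Third-order Taylor expansion in `L¹` of the translates of the standard Gaussian density. -/
theorem exists_lintegral_gaussianPDFReal_taylor_le : ∃ A : ℝ, 0 ≤ A ∧ ∀ y : ℝ,
    ∫⁻ w, ‖gaussianPDFReal 0 1 (w - y) - gaussianPDFReal 0 1 w
      + y * (-w * gaussianPDFReal 0 1 w)
      - y ^ 2 / 2 * ((w ^ 2 - 1) * gaussianPDFReal 0 1 w)‖ₑ ≤ ENNReal.ofReal (A * |y| ^ 3) := by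
  set φ := gaussianPDFReal 0 1 with hφ
  have hd0 : ∀ z, HasDerivAt φ (-z * φ z) z := hasDerivAt_gaussianPDFReal_zero_one
  have hd1 : ∀ z, HasDerivAt (fun z => -z * φ z) ((z ^ 2 - 1) * φ z) z := fun z => by
    exact (((hasDerivAt_id z).neg).mul (hd0 z)).congr_deriv (by simp; ring)
  have hd2 : ∀ z, HasDerivAt (fun z => (z ^ 2 - 1) * φ z) ((3 * z - z ^ 3) * φ z) z := fun z => by
    exact (((hasDerivAt_pow 2 z).sub_const 1).mul (hd0 z)).congr_deriv (by simp; ring)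
  have hcφ : Continuous φ := continuous_iff_continuousAt.2 fun z => (hd0 z).continuousAt
  have hsub : ∀ w t : ℝ, HasDerivAt (fun t => w - t) (-1) t := fun w t => by
    simpa using (hasDerivAt_id t).const_sub w
  have hi : Integrable fun z => (3 * z - z ^ 3) * φ z := by
    convert integrable_cubic_mul_gaussianPDFReal 0 3 0 (-1) using 2
    ring
  have hA : 0 ≤ ∫ z, ‖(3 * z - z ^ 3) * φ z‖ := by positivity
  refine ⟨∫ z, ‖(3 * z - z ^ 3) * φ z‖, hA, ?_⟩
  have s1 := lintegral_enorm_le_of_hasDerivAt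
    (E := fun w t => ((w - t) ^ 2 - 1) * φ (w - t) - (w ^ 2 - 1) * φ w)
    (e := fun w t => -((3 * (w - t) - (w - t) ^ 3) * φ (w - t))) (by simp)
    (fun w t => by
      exact (((hd2 (w - t)).comp t (hsub w t)).sub_const ((w ^ 2 - 1) * φ w)).congr_deriv
        (by ring))
    (by fun_prop) hA (j := 0) (fun t => by
      simp only [enorm_neg]
      rw [lintegral_sub_right_eq_self (fun z => ‖(3 * z - z ^ 3) * φ z‖ₑ) t, pow_zero, mul_one,
        ofReal_integral_norm_eq_lintegral_enorm hi])
  have s2 := lintegral_enorm_le_of_hasDerivAt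
    (E := fun w t => -(w - t) * φ (w - t) - (-w * φ w) + t * ((w ^ 2 - 1) * φ w))
    (e := fun w t => -(((w - t) ^ 2 - 1) * φ (w - t) - (w ^ 2 - 1) * φ w)) (by simp)
    (fun w t => by
      exact ((((hd1 (w - t)).comp t (hsub w t)).sub_const (-w * φ w)).add
        ((hasDerivAt_id t).mul_const ((w ^ 2 - 1) * φ w))).congr_deriv (by ring))
    (by fun_prop) hA (j := 1) (fun t => by simpa only [enorm_neg] using s1 t)
  exact lintegral_enorm_le_of_hasDerivAt
    (E := fun w t => φ (w - t) - φ w + t * (-w * φ w) - t ^ 2 / 2 * ((w ^ 2 - 1) * φ w))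
    (e := fun w t => -(-(w - t) * φ (w - t) - (-w * φ w) + t * ((w ^ 2 - 1) * φ w))) (by simp)
    (fun w t => by
      exact (((((hd0 (w - t)).comp t (hsub w t)).sub_const (φ w)).add
        ((hasDerivAt_id t).mul_const (-w * φ w))).sub
        (((hasDerivAt_pow 2 t).div_const 2).mul_const ((w ^ 2 - 1) * φ w))).congr_deriv
        (by simp; ring))
    (by fun_prop) hA (j := 2) (fun t => by simpa only [enorm_neg] using s2 t)

/-- The Gaussian convolution of a function bounded by `B` agrees with a quadratic polynomial up
to an error `A * B * |y| ^ 3`. -/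
theorem exists_gaussian_convolution_taylor : ∃ A : ℝ, 0 ≤ A ∧ ∀ (h : ℝ → ℝ) (B : ℝ),
    Measurable h → (∀ x, |h x| ≤ B) → ∃ a b c : ℝ, ∀ y : ℝ,
      |(∫ w, h (y + w) ∂(gaussianReal 0 1)) - (a + b * y + c * y ^ 2)| ≤ A * B * |y| ^ 3 := by
  obtain ⟨A, hA, hT⟩ := exists_lintegral_gaussianPDFReal_taylor_le
  refine ⟨A, hA, fun h B hm hB => ?_⟩
  set φ := gaussianPDFReal 0 1 with hφ
  have hB0 : 0 ≤ B := (abs_nonneg _).trans (hB 0)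
  have hbd : ∀ {f : ℝ → ℝ}, Integrable f → Integrable fun w => f w * h w := fun hf =>
    hf.mul_bdd (c := B) hm.aestronglyMeasurable (ae_of_all _ hB)
  have i0 : Integrable φ := integrable_gaussianPDFReal 0 1
  have i1 : Integrable fun w => -w * φ w := by
    convert integrable_cubic_mul_gaussianPDFReal 0 (-1) 0 0 using 2; ring
  have i2 : Integrable fun w => (w ^ 2 - 1) * φ w := by
    convert integrable_cubic_mul_gaussianPDFReal (-1) 0 1 0 using 2; ring
  refine ⟨∫ w, φ w * h w, -∫ w, -w * φ w * h w, (∫ w, (w ^ 2 - 1) * φ w * h w) / 2, fun y => ?_⟩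
  have iy : Integrable fun w => φ (w - y) := i0.comp_sub_right y
  have e1 : ∫ w, h (y + w) ∂(gaussianReal 0 1) = ∫ w, φ (w - y) * h w := by
    rw [integral_gaussianReal_eq_integral_smul one_ne_zero,
      ← integral_sub_right_eq_self (fun w => gaussianPDFReal 0 1 w • h (y + w)) y]
    simp [hφ]
  have e2 : (∫ w, h (y + w) ∂(gaussianReal 0 1)) - ((∫ w, φ w * h w)
      + (-∫ w, -w * φ w * h w) * y + (∫ w, (w ^ 2 - 1) * φ w * h w) / 2 * y ^ 2)
      = ∫ w, (φ (w - y) - φ w + y * (-w * φ w) - y ^ 2 / 2 * ((w ^ 2 - 1) * φ w)) * h w := by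
    have : ∀ w, (φ (w - y) - φ w + y * (-w * φ w) - y ^ 2 / 2 * ((w ^ 2 - 1) * φ w)) * h w
        = φ (w - y) * h w - φ w * h w + y * (-w * φ w * h w)
          - y ^ 2 / 2 * ((w ^ 2 - 1) * φ w * h w) := fun w => by ring
    simp_rw [this]
    rw [integral_sub, integral_add, integral_sub (hbd iy) (hbd i0), integral_const_mul,
      integral_const_mul, e1]
    · ring
    · exact (hbd iy).sub (hbd i0)
    · exact (hbd i1).const_mul y
    · exact ((hbd iy).sub (hbd i0)).add ((hbd i1).const_mul y)
    · exact (hbd i2).const_mul _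
  rw [e2, ← Real.norm_eq_abs]
  have hL : ∫⁻ w, ‖(φ (w - y) - φ w + y * (-w * φ w) - y ^ 2 / 2 * ((w ^ 2 - 1) * φ w)) * h w‖ₑ
      ≤ ENNReal.ofReal (A * B * |y| ^ 3) := by
    calc _ ≤ ∫⁻ w, ‖φ (w - y) - φ w + y * (-w * φ w) - y ^ 2 / 2 * ((w ^ 2 - 1) * φ w)‖ₑ
          * ENNReal.ofReal B := by
          refine lintegral_mono fun w => ?_
          rw [enorm_mul]
          gcongr
          rw [Real.enorm_eq_ofReal_abs]
          exact ENNReal.ofReal_le_ofReal (hB w)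
      _ ≤ ENNReal.ofReal (A * |y| ^ 3) * ENNReal.ofReal B := by
          rw [lintegral_mul_const' _ _ ENNReal.ofReal_ne_top]
          gcongr
          exact hT y
      _ = _ := by rw [← ENNReal.ofReal_mul (by positivity)]; congr 1; ring
  have := (enorm_integral_le_lintegral_enorm _).trans hL
  rw [← ofReal_norm, ENNReal.ofReal_le_ofReal_iff (by positivity)] at this
  exact this

theorem integral_conv_centeredGaussian (μ : Measure ℝ) [IsProbabilityMeasure μ] {v : ℝ}
    (hv : 0 < v) {h : ℝ → ℝ} (hm : Measurable h) {B : ℝ} (hB : ∀ x, |h x| ≤ B) :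
    ∫ z, h z ∂(μ ∗ centeredGaussian v)
      = ∫ y, ∫ w, h (√v * (y / √v + w)) ∂(gaussianReal 0 1) ∂μ := by
  rw [integral_conv_of_bounded _ _ hm hB]
  congr 1
  ext y
  rw [centeredGaussian_eq_map hv.le, integral_map (f := fun w => h (y + w)) (by fun_prop)
    (hm.comp (by fun_prop)).aestronglyMeasurable]
  congr 1
  ext w
  congr 1
  field_simp [(Real.sqrt_pos.2 hv).ne']

/-- The difference between smoothing with a centred law of variance one and smoothing with the
standard Gaussian law is of third order, in total variation: the first two moments agree, so the
quadratic Taylor polynomials cancel. -/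
theorem exists_abs_integral_conv_sub_le : ∃ K : ℝ, 0 ≤ K ∧ ∀ (μ : Measure ℝ)
    [IsProbabilityMeasure μ], MemLp id 3 μ → ∫ y, y ∂μ = 0 → ∫ y, y ^ 2 ∂μ = 1 →
    1 ≤ ∫ y, |y| ^ 3 ∂μ ∧ ∀ (v : ℝ), 0 < v → ∀ (h : ℝ → ℝ) (B : ℝ), Measurable h →
    (∀ x, |h x| ≤ B) →
    |∫ z, h z ∂(μ ∗ centeredGaussian v) - ∫ z, h z ∂(centeredGaussian 1 ∗ centeredGaussian v)|
      ≤ K * (∫ y, |y| ^ 3 ∂μ) * B / √v ^ 3 := by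
  obtain ⟨A, hA, hT⟩ := exists_gaussian_convolution_taylor
  set ρ₁ := ∫ y, |y| ^ 3 ∂(centeredGaussian 1) with hρ₁
  have hρ₁0 : 0 ≤ ρ₁ := by positivity
  have main : ∀ (μ : Measure ℝ) [IsProbabilityMeasure μ], MemLp id 3 μ → ∫ y, y ∂μ = 0 →
      ∫ y, y ^ 2 ∂μ = 1 → ∀ (v : ℝ), 0 < v → ∀ (h : ℝ → ℝ) (B : ℝ), Measurable h →
      (∀ x, |h x| ≤ B) → ∀ a b c : ℝ, (∀ y : ℝ,
      |(∫ w, h (√v * (y + w)) ∂(gaussianReal 0 1)) - (a + b * y + c * y ^ 2)| ≤ A * B * |y| ^ 3) →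
      |∫ z, h z ∂(μ ∗ centeredGaussian v) - (a + c / √v ^ 2)|
        ≤ A * B * (∫ y, |y| ^ 3 ∂μ) / √v ^ 3 := by
    intro μ _ h3 hm1 hm2 v hv h B hm hB a b c habc
    have hs := Real.sqrt_pos.2 hv
    have i3 : Integrable (fun y : ℝ => |y| ^ 3) μ := by
      simpa using h3.integrable_norm_pow'
    have i2 : Integrable (fun y : ℝ => y ^ 2) μ := by
      simpa using (h3.mono_exponent (p := 2) (by norm_num)).integrable_sq
    have i1 : Integrable (fun y : ℝ => y) μ := h3.integrable (by norm_num)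
    have iH : Integrable (fun y => ∫ w, h (√v * (y / √v + w)) ∂(gaussianReal 0 1)) μ := by
      refine Integrable.of_bound (C := B) ?_ (ae_of_all _ fun y => ?_)
      · have : StronglyMeasurable (Function.uncurry fun y w : ℝ => h (√v * (y / √v + w))) :=
          (hm.comp (by fun_prop : Measurable fun p : ℝ × ℝ => √v * (p.1 / √v + p.2)))
            |>.stronglyMeasurable
        exact this.integral_prod_right.aestronglyMeasurable
      · refine (norm_integral_le_of_norm_le_const (ae_of_all _ fun w => hB _)).trans ?_
        simp
    have iq : Integrable (fun y : ℝ => a + b * (y / √v) + c * (y / √v) ^ 2) μ := by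
      refine ((integrable_const a).add ((i1.div_const _).const_mul b)).add ?_
      simp only [div_pow]
      exact (i2.div_const _).const_mul c
    have eq : ∫ y, (a + b * (y / √v) + c * (y / √v) ^ 2) ∂μ = a + c / √v ^ 2 := by
      simp only [div_pow]
      rw [integral_add, integral_add, integral_const_mul, integral_const_mul, integral_div,
        integral_div, hm1, hm2]
      · simp [div_eq_mul_inv]
      · exact integrable_const _
      · exact (i1.div_const _).const_mul b
      · exact (integrable_const a).add ((i1.div_const _).const_mul b)
      · exact (i2.div_const _).const_mul c
    rw [integral_conv_centeredGaussian μ hv hm hB, ← eq, ← integral_sub iH iq]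
    have : A * B * (∫ y, |y| ^ 3 ∂μ) / √v ^ 3 = ∫ y, A * B * |y / √v| ^ 3 ∂μ := by
      simp only [abs_div, div_pow, abs_of_pos hs]
      rw [integral_const_mul, integral_div]
      ring
    rw [this, ← Real.norm_eq_abs]
    refine norm_integral_le_of_norm_le ?_ (ae_of_all _ fun y => habc (y / √v))
    simp only [abs_div, div_pow]
    exact (i3.div_const _).const_mul _
  refine ⟨A * (1 + ρ₁), by positivity, fun μ _ h3 hm1 hm2 => ?_⟩
  have i3 : Integrable (fun y : ℝ => |y| ^ 3) μ := by
    simpa using h3.integrable_norm_pow'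
  have hρ : 1 ≤ ∫ y, |y| ^ 3 ∂μ := by
    have i2 : Integrable (fun y : ℝ => y ^ 2) μ := by
      simpa using (h3.mono_exponent (p := 2) (by norm_num)).integrable_sq
    have : ∫ y, (3 * y ^ 2 - 2 * |y| ^ 3) ∂μ ≤ ∫ y, (1 : ℝ) ∂μ := by
      refine integral_mono ((i2.const_mul 3).sub (i3.const_mul 2)) (integrable_const _) fun y => ?_
      simp only
      rw [← sq_abs y]
      nlinarith [abs_nonneg y, sq_nonneg (|y| - 1), mul_nonneg (abs_nonneg y)
        (sq_nonneg (|y| - 1))]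
    rw [integral_sub (i2.const_mul 3) (i3.const_mul 2), integral_const_mul, integral_const_mul,
      hm2] at this
    simp at this
    linarith
  refine ⟨hρ, fun v hv h B hm hB => ?_⟩
  have hB0 : 0 ≤ B := (abs_nonneg _).trans (hB 0)
  have hs := Real.sqrt_pos.2 hv
  obtain ⟨a, b, c, habc⟩ := hT (fun x => h (√v * x)) B (hm.comp (by fun_prop)) (fun x => hB _)
  have k1 := main μ h3 hm1 hm2 v hv h B hm hB a b c habc
  have k2 := main (centeredGaussian 1)
    (by rw [centeredGaussian_one]; exact memLp_id_gaussianReal 3)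
    (by rw [centeredGaussian_one]; exact integral_id_gaussianReal)
    (by
      have h := variance_fun_id_gaussianReal (μ := 0) (v := 1)
      rw [variance_of_integral_eq_zero (by fun_prop) integral_id_gaussianReal] at h
      rw [centeredGaussian_one]
      simpa using h)
    v hv h B hm hB a b c habc
  rw [← hρ₁] at k2
  calc _ ≤ A * B * (∫ y, |y| ^ 3 ∂μ) / √v ^ 3 + A * B * ρ₁ / √v ^ 3 := by
        rw [abs_le] at *
        constructor <;> linarith [k1.1, k1.2, k2.1, k2.2]
    _ ≤ A * B * (∫ y, |y| ^ 3 ∂μ) / √v ^ 3 + A * B * (ρ₁ * ∫ y, |y| ^ 3 ∂μ) / √v ^ 3 := by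
        gcongr
        exact le_mul_of_one_le_right hρ₁0 hρ
    _ = _ := by ring

/-! ### The Berry–Esseen theorem -/

theorem cdf_gaussianReal_sub_le {x y : ℝ} (hxy : x ≤ y) :
    cdf (gaussianReal 0 1) y - cdf (gaussianReal 0 1) x ≤ y - x := by
  rw [cdf_eq_real, cdf_eq_real, ← measureReal_sdiff (Set.Iic_subset_Iic.2 hxy) measurableSet_Iic,
    Set.Iic_sdiff_Iic]
  have h1 : ∀ z, gaussianPDF 0 1 z ≤ 1 := fun z => by
    rw [gaussianPDF, ← ENNReal.ofReal_one]
    apply ENNReal.ofReal_le_ofReal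
    rw [gaussianPDFReal]
    have : (1 : ℝ) ≤ √(2 * Real.pi * (1 : NNReal)) := by
      rw [Real.one_le_sqrt]
      have := Real.pi_gt_three
      norm_num
      linarith
    refine mul_le_one₀ (inv_le_one_of_one_le₀ this) (Real.exp_pos _).le ?_
    rw [Real.exp_le_one_iff]
    have : 0 ≤ (z - 0) ^ 2 / (2 * ((1 : NNReal) : ℝ)) := by positivity
    rw [neg_div]
    linarith
  have h2 : gaussianReal 0 1 (Set.Ioc x y) ≤ ENNReal.ofReal (y - x) := by
    rw [gaussianReal_apply _ one_ne_zero, ← Real.volume_Ioc, ← setLIntegral_one]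
    exact setLIntegral_mono measurable_const fun z _ => h1 z
  exact ENNReal.toReal_le_of_le_ofReal (by linarith) h2

theorem cdf_centeredGaussian_sub_le {v : ℝ} (hv : 0 < v) {x y : ℝ} (hxy : x ≤ y) :
    cdf (centeredGaussian v) y - cdf (centeredGaussian v) x ≤ (y - x) / √v := by
  rw [cdf_centeredGaussian hv, cdf_centeredGaussian hv, sub_div]
  exact cdf_gaussianReal_sub_le (by gcongr)

/-- A window, in units of the standard deviation, that carries at least three quarters of the mass
of every centred Gaussian law. -/
theorem exists_centeredGaussian_Icc_ge : ∃ a : ℝ, 0 < a ∧ ∀ v : ℝ, 0 < v →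
    3 / 4 ≤ (centeredGaussian v).real (Set.Icc (-(a * √v)) (a * √v)) := by
  have h1 := (tendsto_cdf_atTop (gaussianReal 0 1)).eventually (lt_mem_nhds (by norm_num :
    (7 / 8 : ℝ) < 1))
  have h2 := ((tendsto_cdf_atBot (gaussianReal 0 1)).comp
    Filter.tendsto_neg_atTop_atBot).eventually (gt_mem_nhds (by norm_num : (0 : ℝ) < 1 / 8))
  obtain ⟨a, ha1, ha2, ha⟩ := (h1.and (h2.and (Filter.eventually_gt_atTop 0))).exists
  refine ⟨a, ha, fun v hv => ?_⟩
  have hs := Real.sqrt_pos.2 hv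
  have hle : -(a * √v) ≤ a * √v := by nlinarith [mul_pos ha hs]
  have h3 : (centeredGaussian v).real (Set.Ioc (-(a * √v)) (a * √v))
      = cdf (gaussianReal 0 1) a - cdf (gaussianReal 0 1) (-a) := by
    rw [← Set.Iic_sdiff_Iic, measureReal_sdiff (Set.Iic_subset_Iic.2 hle) measurableSet_Iic,
      ← cdf_eq_real, ← cdf_eq_real, cdf_centeredGaussian hv, cdf_centeredGaussian hv, neg_div,
      mul_div_cancel_right₀ _ hs.ne']
  have h4 := measureReal_mono (μ := centeredGaussian v)
    (Set.Ioc_subset_Icc_self (a := -(a * √v)) (b := a * √v))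
  simp only [Function.comp] at ha2
  linarith

/-- A function bounded by `δ` that is at least `y` on a set of probability `3/4` has a mean
which controls `y`. -/
theorem le_integral_of_le_on (γ : Measure ℝ) [IsProbabilityMeasure γ] {S : Set ℝ}
    (hS : MeasurableSet S) (hγ : 3 / 4 ≤ γ.real S) {q : ℝ → ℝ} (hq : Measurable q) {δ y D : ℝ}
    (hδ : ∀ w, |q w| ≤ δ) (hy : ∀ w ∈ S, y ≤ q w) (hD : |∫ w, q w ∂γ| ≤ D) :
    y ≤ 4 / 3 * D + δ / 3 := by
  have hδ0 : 0 ≤ δ := (abs_nonneg _).trans (hδ 0)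
  have hD0 : 0 ≤ D := (abs_nonneg _).trans hD
  by_cases hy0 : y < 0
  · linarith
  push Not at hy0
  have h1 : ∫ w, (S.indicator (fun _ => y + δ) w - δ) ∂γ ≤ ∫ w, q w ∂γ := by
    refine integral_mono (((integrable_const _).indicator hS).sub (integrable_const _))
      (integrable_of_abs_le γ hq hδ) fun w => ?_
    by_cases hw : w ∈ S
    · simpa [hw] using hy w hw
    · simpa [hw] using (abs_le.1 (hδ w)).1
  rw [integral_sub ((integrable_const _).indicator hS) (integrable_const _),
    integral_indicator_const _ hS] at h1
  simp only [smul_eq_mul, integral_const, probReal_univ, one_mul] at h1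
  have := (abs_le.1 hD).2
  nlinarith

/-- Gaussian smoothing inequality: the Kolmogorov distance to a Gaussian law is controlled by the
distance after smoothing and by the width of the smoothing kernel. -/
theorem exists_kolmogorov_smoothing : ∃ a : ℝ, 0 < a ∧ ∀ (P : Measure ℝ)
    [IsProbabilityMeasure P] (N M D : ℝ), 0 < N → 0 < M →
    (∀ x, |cdf (P ∗ centeredGaussian M) x - cdf (centeredGaussian N ∗ centeredGaussian M) x| ≤ D) →
    ∀ x, |cdf P x - cdf (centeredGaussian N) x| ≤ 2 * D + 3 * a * √M / √N := by
  obtain ⟨a, ha, hγ⟩ := exists_centeredGaussian_Icc_ge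
  refine ⟨a, ha, fun P _ N M D hN hM hD => ?_⟩
  set G := cdf (centeredGaussian N) with hG
  set b := a * √M with hb
  have hb0 : 0 < b := mul_pos ha (Real.sqrt_pos.2 hM)
  have hbdd : BddAbove (Set.range fun x => |cdf P x - G x|) :=
    ⟨1, by rintro _ ⟨x, rfl⟩; exact abs_cdf_sub_le_one _ _ _ _⟩
  set δ := ⨆ x, |cdf P x - G x| with hδ
  have hle : ∀ x, |cdf P x - G x| ≤ δ := fun x => le_ciSup hbdd x
  have hm : ∀ z, Measurable fun w => cdf P (z - w) - G (z - w) := fun z =>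
    ((measurable_cdf P).comp (by fun_prop)).sub ((measurable_cdf _).comp (by fun_prop))
  have hDz : ∀ z, |∫ w, (cdf P (z - w) - G (z - w)) ∂(centeredGaussian M)| ≤ D := fun z => by
    rw [integral_sub (integrable_cdf_sub _ _ _) (integrable_cdf_sub _ _ _), ← cdf_conv, ← cdf_conv]
    exact hD z
  have hkey : ∀ x, |cdf P x - G x| ≤ 4 / 3 * D + δ / 3 + 2 * b / √N := fun x => by
    rw [abs_le]
    constructor
    · have := le_integral_of_le_on (centeredGaussian M) measurableSet_Icc (hγ M hM)
        (hm (x - b)).neg (y := -(cdf P x - G x) - 2 * b / √N) (δ := δ) (D := D)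
        (fun w => by rw [Pi.neg_apply, abs_neg]; exact hle _)
        (fun w hw => by
          obtain ⟨h1, h2⟩ := hw
          have e1 := monotone_cdf P (by linarith : x - b - w ≤ x)
          have e2 := cdf_centeredGaussian_sub_le hN (by linarith : x - 2 * b ≤ x)
          have e3 := monotone_cdf (centeredGaussian N) (by linarith : x - 2 * b ≤ x - b - w)
          have e4 : (x - (x - 2 * b)) / √N = 2 * b / √N := by congr 1; ring
          rw [e4] at e2
          simp only [Pi.neg_apply, hG]
          linarith)
        (by simp only [Pi.neg_apply, integral_neg, abs_neg]; exact hDz _)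
      linarith
    · have := le_integral_of_le_on (centeredGaussian M) measurableSet_Icc (hγ M hM)
        (hm (x + b)) (y := (cdf P x - G x) - 2 * b / √N) (δ := δ) (D := D)
        (fun w => hle _)
        (fun w hw => by
          obtain ⟨h1, h2⟩ := hw
          have e1 := monotone_cdf P (by linarith : x ≤ x + b - w)
          have e2 := cdf_centeredGaussian_sub_le hN (by linarith : x ≤ x + 2 * b)
          have e3 := monotone_cdf (centeredGaussian N) (by linarith : x + b - w ≤ x + 2 * b)
          have e4 : (x + 2 * b - x) / √N = 2 * b / √N := by congr 1; ring
          rw [e4] at e2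
          simp only [hG]
          linarith)
        (hDz _)
      linarith
  have hδ2 : δ ≤ 4 / 3 * D + δ / 3 + 2 * b / √N := ciSup_le hkey
  intro x
  have e : 3 * a * √M / √N = 3 / 2 * (2 * b / √N) := by rw [hb]; ring
  rw [e]
  linarith [hle x]

/-- One step of the replacement of the summands by Gaussian ones, with a remaining Gaussian
smoothing of variance `v`. The law `P` of the summands not yet replaced enters through its own
distance `δ` to a Gaussian law; the contribution of that Gaussian law itself is smoothed at the
larger scale `w + v`. -/
theorem exists_replacement_bound : ∃ K : ℝ, 0 ≤ K ∧ ∀ (μ : Measure ℝ)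
    [IsProbabilityMeasure μ], MemLp id 3 μ → ∫ y, y ∂μ = 0 → ∫ y, y ^ 2 ∂μ = 1 →
    1 ≤ ∫ y, |y| ^ 3 ∂μ ∧ ∀ (P : Measure ℝ) [IsProbabilityMeasure P] (v w δ : ℝ), 0 < v → 0 ≤ w →
      (∀ x, |cdf P x - cdf (centeredGaussian w) x| ≤ δ) → ∀ x,
      |cdf ((P ∗ μ) ∗ centeredGaussian v) x - cdf (P ∗ centeredGaussian (1 + v)) x|
        ≤ K * (∫ y, |y| ^ 3 ∂μ) * (δ / √v ^ 3 + 1 / √(w + v) ^ 3) := by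
  obtain ⟨K, hK, h⟩ := exists_abs_integral_conv_sub_le
  refine ⟨K, hK, fun μ _ h3 hm1 hm2 => ?_⟩
  obtain ⟨hρ, hmain⟩ := h μ h3 hm1 hm2
  refine ⟨hρ, fun P _ v w δ hv hw hδ x => ?_⟩
  set G := centeredGaussian w with hG
  have b1 := hmain v hv (fun t => cdf P (x - t) - cdf G (x - t)) δ
    (((measurable_cdf P).comp (by fun_prop)).sub ((measurable_cdf _).comp (by fun_prop)))
    (fun t => hδ _)
  rw [integral_sub (integrable_cdf_sub _ _ _) (integrable_cdf_sub _ _ _),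
    integral_sub (integrable_cdf_sub _ _ _) (integrable_cdf_sub _ _ _),
    ← cdf_conv, ← cdf_conv, ← cdf_conv, ← cdf_conv] at b1
  have b2 := hmain (w + v) (by linarith) ((Set.Iic x).indicator fun _ => 1) 1
    (measurable_const.indicator measurableSet_Iic) (abs_indicator_one_le _)
  rw [← cdf_eq_integral_indicator, ← cdf_eq_integral_indicator] at b2
  have e1 : (P ∗ μ) ∗ centeredGaussian v = P ∗ (μ ∗ centeredGaussian v) := Measure.conv_assoc _ _ _
  have e2 : centeredGaussian (1 + v) = centeredGaussian 1 ∗ centeredGaussian v :=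
    (centeredGaussian_conv zero_le_one hv.le).symm
  have e3 : μ ∗ centeredGaussian (w + v) = G ∗ (μ ∗ centeredGaussian v) := by
    rw [← centeredGaussian_conv hw hv.le, ← Measure.conv_assoc, ← Measure.conv_assoc,
      Measure.conv_comm μ]
  have e4 : centeredGaussian 1 ∗ centeredGaussian (w + v)
      = G ∗ (centeredGaussian 1 ∗ centeredGaussian v) := by
    rw [← centeredGaussian_conv hw hv.le, ← Measure.conv_assoc, ← Measure.conv_assoc,
      Measure.conv_comm (centeredGaussian 1)]
  rw [e3, e4] at b2
  rw [e1, e2]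
  have e5 : K * (∫ y, |y| ^ 3 ∂μ) * (δ / √v ^ 3 + 1 / √(w + v) ^ 3)
      = K * (∫ y, |y| ^ 3 ∂μ) * δ / √v ^ 3 + K * (∫ y, |y| ^ 3 ∂μ) * 1 / √(w + v) ^ 3 := by ring
  rw [e5]
  rw [abs_le] at *
  constructor <;> linarith [b1.1, b1.2, b2.1, b2.2]

theorem inv_sqrt_cube_le {u : ℝ} (hu : 1 ≤ u) : 1 / √u ^ 3 ≤ 4 / √u - 4 / √(u + 1) := by
  have hb : 0 < √u := Real.sqrt_pos.2 (by linarith)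
  have hc : 0 < √(u + 1) := Real.sqrt_pos.2 (by linarith)
  have hb2 := Real.sq_sqrt (by linarith : 0 ≤ u)
  have hc2 := Real.sq_sqrt (by linarith : 0 ≤ u + 1)
  set b := √u
  set c := √(u + 1)
  -- After clearing denominators, use `c - b = 1 / (c + b)`.
  have hcb : (c - b) * (c + b) = 1 := by nlinarith
  have h1 : c * (c + b) ≤ 4 * b ^ 2 := by nlinarith [sq_nonneg (c - b)]
  have h2 : c ≤ 4 * b ^ 2 * (c - b) := by
    have hpos : 0 < c + b := by linarith
    refine le_of_mul_le_mul_right ?_ hpos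
    calc c * (c + b) ≤ 4 * b ^ 2 := h1
      _ = _ := by rw [mul_assoc, hcb, mul_one]
  rw [div_sub_div _ _ hb.ne' hc.ne', div_le_div_iff₀ (by positivity) (by positivity)]
  nlinarith [mul_le_mul_of_nonneg_left h2 hb.le]

theorem sum_inv_sqrt_cube_le {M : ℝ} (hM : 1 ≤ M) (n : ℕ) :
    ∑ j ∈ Finset.range n, 1 / √((j : ℝ) + M) ^ 3 ≤ 4 / √M := by
  have key : ∑ j ∈ Finset.range n, 1 / √((j : ℝ) + M) ^ 3 ≤ 4 / √M - 4 / √((n : ℝ) + M) := by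
    induction n with
    | zero => simp
    | succ n ih =>
      rw [Finset.sum_range_succ]
      have h := inv_sqrt_cube_le (u := n + M) (by linarith [(Nat.cast_nonneg n : (0 : ℝ) ≤ n)])
      have e : ((n + 1 : ℕ) : ℝ) + M = n + M + 1 := by push_cast; ring
      rw [e]
      linarith
  have : 0 ≤ 4 / √((n : ℝ) + M) := by positivity
  linarith

/-- Bound on the weighted distances of the partial sums. For `k ≥ n / 2` the bound on the `k`-th
distance is used; for `k < n / 2` the weight is small and the trivial bound `1` suffices. -/
theorem exists_distance_bound {μ : Measure ℝ} {n k : ℕ} {R M : ℝ} (hR : 0 ≤ R) (hM : 1 ≤ M)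
    (hkn : k < n)
    (ih : 1 ≤ k → ∀ x, |cdf (iidSumLaw μ k) x - cdf (centeredGaussian k) x| ≤ R / √(k : ℝ)) :
    ∃ δ : ℝ, (∀ x, |cdf (iidSumLaw μ k) x - cdf (centeredGaussian k) x| ≤ δ) ∧
      δ / √((n : ℝ) - 1 - k + M) ^ 3
        ≤ 2 * R / √(n : ℝ) * (1 / √((n : ℝ) - 1 - k + M) ^ 3) + 4 / √(n : ℝ) ^ 3 := by
  have hkn' : (k : ℝ) + 1 ≤ n := by exact_mod_cast hkn
  have hk0 : (0 : ℝ) ≤ k := Nat.cast_nonneg k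
  have hn : 0 < √(n : ℝ) := Real.sqrt_pos.2 (by linarith)
  have hv : 0 < √((n : ℝ) - 1 - k + M) := Real.sqrt_pos.2 (by linarith)
  have hhalf : √(n : ℝ) / 2 = √((n : ℝ) / 4) := by
    rw [Real.sqrt_div' _ (by norm_num)]
    congr 1
    rw [show (4 : ℝ) = 2 ^ 2 by norm_num, Real.sqrt_sq (by norm_num)]
  by_cases hc : n ≤ 2 * k
  · have hc' : (n : ℝ) ≤ 2 * k := by exact_mod_cast hc
    refine ⟨2 * R / √(n : ℝ), fun x => (ih (by omega) x).trans ?_, ?_⟩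
    · have : √(n : ℝ) / 2 ≤ √(k : ℝ) := by
        rw [hhalf]; exact Real.sqrt_le_sqrt (by linarith)
      calc R / √(k : ℝ) ≤ R / (√(n : ℝ) / 2) := by gcongr
        _ = _ := by field_simp
    · have : 0 ≤ 4 / √(n : ℝ) ^ 3 := by positivity
      rw [mul_one_div]
      linarith
  · have hc' : 2 * (k : ℝ) + 1 ≤ n := by
      have : 2 * k + 1 ≤ n := by omega
      exact_mod_cast this
    refine ⟨1, fun x => abs_cdf_sub_le_one _ _ _ _, ?_⟩
    have h1 : 0 ≤ 2 * R / √(n : ℝ) * (1 / √((n : ℝ) - 1 - k + M) ^ 3) := by positivity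
    have h2 : 1 / √((n : ℝ) - 1 - k + M) ^ 3 ≤ 4 / √(n : ℝ) ^ 3 := by
      rw [div_le_div_iff₀ (by positivity) (by positivity)]
      have h3 : √(n : ℝ) ≤ √2 * √((n : ℝ) - 1 - k + M) := by
        rw [← Real.sqrt_mul (by norm_num)]
        exact Real.sqrt_le_sqrt (by linarith)
      have h4 : √2 ^ 3 ≤ 4 := by
        have h5 : √2 ≤ 2 := Real.sqrt_le_iff.2 ⟨by norm_num, by norm_num⟩
        have h6 := Real.sq_sqrt (by norm_num : (0 : ℝ) ≤ 2)
        calc √2 ^ 3 = √2 ^ 2 * √2 := by ring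
          _ ≤ 4 := by rw [h6]; linarith
      calc 1 * √(n : ℝ) ^ 3 ≤ (√2 * √((n : ℝ) - 1 - k + M)) ^ 3 := by
            rw [one_mul]; gcongr
        _ = √2 ^ 3 * √((n : ℝ) - 1 - k + M) ^ 3 := by ring
        _ ≤ _ := by gcongr
    linarith

/-- Berry–Esseen bound for centred summands with variance one. -/
theorem exists_berryEsseen_standardized : ∃ C : ℝ, 0 ≤ C ∧ ∀ (μ : Measure ℝ)
    [IsProbabilityMeasure μ], MemLp id 3 μ → ∫ y, y ∂μ = 0 → ∫ y, y ^ 2 ∂μ = 1 →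
    ∀ n : ℕ, 1 ≤ n → ∀ x,
      |cdf (iidSumLaw μ n) x - cdf (centeredGaussian n) x| ≤ C * (∫ y, |y| ^ 3 ∂μ) / √(n : ℝ) := by
  obtain ⟨K, hK, hrepl⟩ := exists_replacement_bound
  obtain ⟨a, ha, hsmooth⟩ := exists_kolmogorov_smoothing
  -- The width `√M = T * ρ` of the smoothing is taken so large that the recursive term contributes
  -- at most half of the bound that is being propagated.
  set T := 32 * K + 1 with hT
  set C := 2 * (10 * K + 3 * a * T) with hC
  have hT1 : 1 ≤ T := by linarith
  have hC0 : 0 ≤ C := by positivity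
  refine ⟨C, hC0, fun μ _ h3 hm1 hm2 n => ?_⟩
  obtain ⟨hρ, hstep⟩ := hrepl μ h3 hm1 hm2
  set ρ := ∫ y, |y| ^ 3 ∂μ with hρdef
  have hρ0 : 0 < ρ := by linarith
  induction n using Nat.strong_induction_on with
  | _ n ih =>
  intro hn
  have hnR : (1 : ℝ) ≤ n := by exact_mod_cast hn
  set M := (T * ρ) ^ 2 with hM
  have hTρ : 1 ≤ T * ρ := by nlinarith
  have hM1 : 1 ≤ M := by rw [hM]; nlinarith
  have hsM : √M = T * ρ := Real.sqrt_sq (by linarith)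
  have hsn : 0 < √(n : ℝ) := Real.sqrt_pos.2 (by linarith)
  have hsn2 : √(n : ℝ) ^ 2 = n := Real.sq_sqrt (by linarith)
  set D := K * ρ * (2 * (C * ρ) / √(n : ℝ) * (4 / √M) + n * (5 / √(n : ℝ) ^ 3)) with hD
  have hDle : ∀ x, |cdf (iidSumLaw μ n ∗ centeredGaussian M) x
      - cdf (centeredGaussian n ∗ centeredGaussian M) x| ≤ D := by
    intro x
    set f : ℕ → ℝ := fun k => cdf (iidSumLaw μ k ∗ centeredGaussian ((n : ℝ) - k + M)) x with hf
    have hfn : f n = cdf (iidSumLaw μ n ∗ centeredGaussian M) x := by simp [hf]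
    have hf0 : f 0 = cdf (centeredGaussian n ∗ centeredGaussian M) x := by
      simp only [hf]
      rw [iidSumLaw_zero, Measure.dirac_zero_conv, centeredGaussian_conv (by linarith)
        (by linarith)]
      simp
    rw [← hfn, ← hf0, ← Finset.sum_range_sub]
    have hterm : ∀ k ∈ Finset.range n, |f (k + 1) - f k| ≤ K * ρ *
        (2 * (C * ρ) / √(n : ℝ) * (1 / √((n : ℝ) - 1 - k + M) ^ 3) + 5 / √(n : ℝ) ^ 3) := by
      intro k hk
      have hkn := Finset.mem_range.1 hk
      have hkn' : (k : ℝ) + 1 ≤ n := by exact_mod_cast hkn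
      obtain ⟨δ, hδ1, hδ2⟩ := exists_distance_bound (μ := μ) (R := C * ρ) (M := M)
        (by positivity) hM1 hkn (fun hk1 => ih k hkn hk1)
      have h := hstep (iidSumLaw μ k) ((n : ℝ) - 1 - k + M) k δ (by linarith)
        (Nat.cast_nonneg k) hδ1 x
      have e1 : (n : ℝ) - (k + 1 : ℕ) + M = (n : ℝ) - 1 - k + M := by push_cast; ring
      have e2 : 1 + ((n : ℝ) - 1 - k + M) = (n : ℝ) - k + M := by ring
      simp only [hf]
      rw [iidSumLaw_succ, e1, ← e2]
      refine h.trans (mul_le_mul_of_nonneg_left ?_ (by positivity))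
      have h5 : 1 / √((k : ℝ) + ((n : ℝ) - 1 - k + M)) ^ 3 ≤ 1 / √(n : ℝ) ^ 3 := by
        gcongr
        linarith
      have e3 : 5 / √(n : ℝ) ^ 3 = 4 / √(n : ℝ) ^ 3 + 1 / √(n : ℝ) ^ 3 := by ring
      rw [e3]
      linarith
    refine (Finset.abs_sum_le_sum_abs _ _).trans ((Finset.sum_le_sum hterm).trans ?_)
    rw [← Finset.mul_sum, Finset.sum_add_distrib, ← Finset.mul_sum, Finset.sum_const,
      Finset.card_range, nsmul_eq_mul, hD]
    gcongr
    rw [← Finset.sum_range_reflect]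
    refine le_trans (le_of_eq ?_) (sum_inv_sqrt_cube_le hM1 n)
    refine Finset.sum_congr rfl fun j hj => ?_
    have hj' := Finset.mem_range.1 hj
    congr 3
    rw [Nat.cast_sub (by omega), Nat.cast_sub (by omega)]
    push_cast
    ring
  intro x
  refine (hsmooth (iidSumLaw μ n) n M D (by linarith) (by linarith) hDle x).trans ?_
  have hD2 : D = K * ρ * (8 * C / T + 5) / √(n : ℝ) := by
    rw [hD, hsM]
    nth_rewrite 2 [← hsn2]
    field_simp
    ring
  have hCT : 16 * K * C / T ≤ C / 2 := by
    rw [div_le_div_iff₀ (by linarith) (by norm_num)]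
    nlinarith
  rw [hD2, hsM]
  have e : 2 * (K * ρ * (8 * C / T + 5) / √(n : ℝ)) + 3 * a * (T * ρ) / √(n : ℝ)
      = (16 * K * C / T + (10 * K + 3 * a * T)) * ρ / √(n : ℝ) := by ring
  rw [e]
  gcongr
  linarith

theorem memLp_map_div_sub {ν : Measure ℝ} [IsProbabilityMeasure ν] {p : ENNReal}
    (h : MemLp id p ν) (m s : ℝ) : MemLp id p (ν.map (fun y => (y - m) / s)) := by
  rw [memLp_map_measure_iff (by fun_prop) (by fun_prop)]
  have := (h.sub (memLp_const m)).mul_const s⁻¹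
  exact this

/-- The Berry–Esseen theorem, with an unspecified constant. -/
theorem exists_isBerryEsseenBound : ∃ C : ℝ, IsBerryEsseenBound C := by
  obtain ⟨C, -, hC⟩ := exists_berryEsseen_standardized
  refine ⟨C, fun ν _ h3 m σ hm hσ hσ0 n hn x => ?_⟩
  have hμ : IsProbabilityMeasure (ν.map (fun y => (y - m) / σ)) :=
    Measure.isProbabilityMeasure_map (by fun_prop)
  have hsn : 0 < √(n : ℝ) := Real.sqrt_pos.2 (by exact_mod_cast hn)
  have i1 : Integrable (fun y : ℝ => y) ν := h3.integrable (by norm_num)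
  have hvar : σ ^ 2 = ∫ y, (y - m) ^ 2 ∂ν := by
    rw [hσ, Real.sq_sqrt (variance_nonneg _ _), variance_eq_integral (by fun_prop), hm]
    rfl
  have h := hC (ν.map (fun y => (y - m) / σ)) (memLp_map_div_sub h3 m σ)
    (by
      rw [integral_map (by fun_prop) (by fun_prop), integral_div,
        integral_sub i1 (integrable_const _), ← hm]
      simp)
    (by
      rw [integral_map (by fun_prop) (by fun_prop)]
      simp only [div_pow]
      rw [integral_div, ← hvar, div_self (by positivity)]) n hn (0 + √(n : ℝ) * x)
  rw [iidSumLaw_map_standardize, cdf_map_div_sub _ _ hsn]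
  rw [cdf_centeredGaussian (by exact_mod_cast hn), integral_map (by fun_prop) (by fun_prop)] at h
  simp only [abs_div, div_pow, abs_of_pos hσ0] at h
  rw [integral_div, zero_add, mul_div_cancel_left₀ _ hsn.ne'] at h
  rw [zero_add]
  refine h.trans (le_of_eq ?_)
  field_simp

theorem IsBerryEsseenBound.nonneg {C : ℝ} (hC : IsBerryEsseenBound C) : 0 ≤ C := by
  have h3 : MemLp id 3 (gaussianReal 0 1) := memLp_id_gaussianReal 3
  have h := hC (gaussianReal 0 1) inferInstance h3 0 1
    integral_id_gaussianReal.symm (by simp [variance_id_gaussianReal]) one_pos 1 le_rfl 0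
  have hpos : 0 < ∫ y : ℝ, |y - 0| ^ 3 ∂(gaussianReal 0 1) := by
    have i : Integrable (fun y : ℝ => |y - 0| ^ 3) (gaussianReal 0 1) := by
      simpa using h3.integrable_norm_pow'
    rw [integral_pos_iff_support_of_nonneg (fun y => by positivity) i]
    have hs : (Function.support fun y : ℝ => |y - 0| ^ 3) = {0}ᶜ := by
      ext y; simp
    have := nullSingletonClass_gaussianReal (μ := 0) (v := 1) one_ne_zero
    rw [hs, prob_compl_eq_one_iff (measurableSet_singleton _) |>.2 (measure_singleton _)]
    exact one_pos
  have h0 := (abs_nonneg _).trans h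
  by_contra! hneg
  have : C * (∫ y : ℝ, |y - 0| ^ 3 ∂(gaussianReal 0 1)) / (1 ^ 3 * √((1 : ℕ) : ℝ)) < 0 := by
    simp only [Nat.cast_one, Real.sqrt_one, one_pow, mul_one, div_one]
    exact mul_neg_of_neg_of_pos hneg hpos
  linarith

theorem isClosed_setOf_isBerryEsseenBound : IsClosed {C : ℝ | IsBerryEsseenBound C} := by
  simp only [IsBerryEsseenBound, Set.ofPred_forall]
  refine isClosed_iInter fun ν => isClosed_iInter fun _ => isClosed_iInter fun _ =>
    isClosed_iInter fun m => isClosed_iInter fun σ => isClosed_iInter fun _ =>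
    isClosed_iInter fun _ => isClosed_iInter fun _ => isClosed_iInter fun n =>
    isClosed_iInter fun _ => isClosed_iInter fun x => isClosed_le continuous_const (by fun_prop)

theorem exists_isLeast_isBerryEsseenBound : ∃ c : ℝ, IsLeast {C : ℝ | IsBerryEsseenBound C} c := by
  have hbdd : BddBelow {C : ℝ | IsBerryEsseenBound C} := ⟨0, fun C hC => hC.nonneg⟩
  exact ⟨_, isClosed_setOf_isBerryEsseenBound.csInf_mem exists_isBerryEsseenBound hbdd,
    fun C hC => csInf_le hbdd hC⟩

/-! ### Convolution roots of infinitely divisible laws on the half line -/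

/-- A law whose characteristic function has real part at least `1 - C z ^ 2` has a finite second
moment, by Fatou's lemma applied to `1 - cos (z x)` with `z → 0`. -/
theorem integrable_of_re_charFun_ge {ζ : Measure ℝ} [IsProbabilityMeasure ζ] {C : ℝ}
    (h : ∀ z, 1 - C * z ^ 2 ≤ (charFun ζ z).re) : Integrable (fun x : ℝ => x ^ 2) ζ := by
  -- `f k` dominates `x ^ 2` on `|x| ≤ π (k + 1)`, by the quadratic upper bound for the cosine.
  set f : ℕ → ℝ → ℝ := fun k x =>
    Real.pi ^ 2 / 2 * ((k : ℝ) + 1) ^ 2 * (1 - Real.cos (((k : ℝ) + 1)⁻¹ * x)) with hf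
  have hf0 : ∀ k x, 0 ≤ f k x := fun k x => by
    have := Real.cos_le_one (((k : ℝ) + 1)⁻¹ * x)
    have : 0 ≤ 1 - Real.cos (((k : ℝ) + 1)⁻¹ * x) := by linarith
    positivity
  have hfx : ∀ x : ℝ, ∀ᶠ k : ℕ in Filter.atTop, x ^ 2 ≤ f k x := fun x => by
    filter_upwards [Filter.eventually_ge_atTop ⌈|x|⌉₊] with k hk
    have hk1 : 0 < (k : ℝ) + 1 := by positivity
    have hx : |x| ≤ (k : ℝ) := (Nat.le_ceil _).trans (by exact_mod_cast hk)
    have h1 : |((k : ℝ) + 1)⁻¹ * x| ≤ Real.pi := by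
      rw [abs_mul, abs_of_pos (inv_pos.2 hk1), inv_mul_le_iff₀ hk1]
      nlinarith [Real.pi_gt_three, abs_nonneg x]
    have h2 := Real.cos_le_one_sub_mul_cos_sq h1
    calc x ^ 2 = Real.pi ^ 2 / 2 * ((k : ℝ) + 1) ^ 2
          * (2 / Real.pi ^ 2 * (((k : ℝ) + 1)⁻¹ * x) ^ 2) := by
          have := Real.pi_ne_zero
          field_simp
      _ ≤ f k x := by
          simp only [hf]
          gcongr
          linarith
  have hfi : ∀ k, ∫⁻ x, ENNReal.ofReal (f k x) ∂ζ ≤ ENNReal.ofReal (Real.pi ^ 2 / 2 * C) := by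
    intro k
    have hk1 : 0 < (k : ℝ) + 1 := by positivity
    have ic : Integrable (fun x => Real.cos (((k : ℝ) + 1)⁻¹ * x)) ζ :=
      integrable_of_abs_le ζ (by fun_prop) (fun x => Real.abs_cos_le_one _)
    have hi : Integrable (f k) ζ := ((integrable_const _).sub ic).const_mul _
    rw [← ofReal_integral_eq_lintegral_ofReal hi (ae_of_all _ (hf0 k))]
    apply ENNReal.ofReal_le_ofReal
    have hre : (charFun ζ ((k : ℝ) + 1)⁻¹).re = ∫ x, Real.cos (((k : ℝ) + 1)⁻¹ * x) ∂ζ := by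
      rw [charFun_apply_real]
      have hint : Integrable (fun x : ℝ =>
          Complex.exp ((((k : ℝ) + 1)⁻¹ : ℝ) * (x : ℂ) * Complex.I)) ζ := by
        refine Integrable.of_bound (by fun_prop) 1 (ae_of_all _ fun x => ?_)
        rw [← Complex.ofReal_mul, Complex.norm_exp_ofReal_mul_I]
      rw [← RCLike.re_eq_complex_re, ← integral_re hint]
      congr 1
      ext x
      rw [← Complex.ofReal_mul, RCLike.re_eq_complex_re, Complex.exp_ofReal_mul_I_re]
    have h1 := h ((k : ℝ) + 1)⁻¹
    simp only [hf]
    rw [integral_const_mul, integral_sub (integrable_const _) ic, ← hre]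
    simp only [integral_const, probReal_univ, smul_eq_mul, one_mul]
    have h2 : 1 - (charFun ζ ((k : ℝ) + 1)⁻¹).re ≤ C * (((k : ℝ) + 1)⁻¹) ^ 2 := by linarith
    calc _ ≤ Real.pi ^ 2 / 2 * ((k : ℝ) + 1) ^ 2 * (C * (((k : ℝ) + 1)⁻¹) ^ 2) := by gcongr
      _ = _ := by field_simp
  have hfin : ∫⁻ x, ENNReal.ofReal (x ^ 2) ∂ζ ≤ ENNReal.ofReal (Real.pi ^ 2 / 2 * C) := by
    calc ∫⁻ x, ENNReal.ofReal (x ^ 2) ∂ζ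
        ≤ ∫⁻ x, Filter.liminf (fun k => ENNReal.ofReal (f k x)) Filter.atTop ∂ζ := by
          refine lintegral_mono fun x => Filter.le_liminf_of_le (by isBoundedDefault) ?_
          filter_upwards [hfx x] with k hk
          exact ENNReal.ofReal_le_ofReal hk
      _ ≤ Filter.liminf (fun k => ∫⁻ x, ENNReal.ofReal (f k x) ∂ζ) Filter.atTop :=
          lintegral_liminf_le fun k => by fun_prop
      _ ≤ _ := Filter.liminf_le_of_le (by isBoundedDefault) fun b hb => by
          obtain ⟨k, hk⟩ := hb.exists
          exact hk.trans (hfi k)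
  refine ⟨by fun_prop, ?_⟩
  rw [hasFiniteIntegral_iff_ofReal (ae_of_all _ fun x => sq_nonneg x)]
  exact hfin.trans_lt ENNReal.ofReal_lt_top

/-- Square integrability is read off from the symmetrised law, whose characteristic function is
`‖charFun ν‖ ^ 2`. -/
theorem memLp_two_of_norm_charFun_sq_ge {ν : Measure ℝ} [IsProbabilityMeasure ν] {C : ℝ}
    (h : ∀ z, 1 - C * z ^ 2 ≤ ‖charFun ν z‖ ^ 2) : MemLp id 2 ν := by
  have hp : IsProbabilityMeasure (ν.map (fun x => -x)) :=
    Measure.isProbabilityMeasure_map (by fun_prop)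
  have h1 : Integrable (fun x : ℝ => x ^ 2) (ν ∗ ν.map (fun x => -x)) := by
    refine integrable_of_re_charFun_ge (C := C) fun z => ?_
    rw [charFun_conv, charFun_map_neg_real, charFun_neg, Complex.mul_conj,
      Complex.normSq_eq_norm_sq, Complex.ofReal_re]
    exact h z
  rw [Measure.conv, integrable_map_measure (by fun_prop) (by fun_prop)] at h1
  obtain ⟨y, hy⟩ := h1.prod_left_ae.exists
  have h2 : MemLp (fun x : ℝ => x + y) 2 ν := (memLp_two_iff_integrable_sq (by fun_prop)).2 hy
  convert h2.sub (memLp_const y) using 1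
  ext x
  simp

/-- The size-biased measure `x F(dx)` of a measure `F` on `(0, ∞)`. Mass of `F` on `(-∞, 0]` would be
discarded. -/
noncomputable def sizeBias (F : Measure ℝ) : Measure ℝ :=
  F.withDensity fun x => ENNReal.ofReal x

theorem isFiniteMeasure_sizeBias {F : Measure ℝ} (h1 : Integrable (fun x : ℝ => x) F) :
    IsFiniteMeasure (sizeBias F) := by
  refine isFiniteMeasure_withDensity ?_
  exact h1.lintegral_lt_top.ne

theorem charFun_sizeBias {F : Measure ℝ} (hpos : ∀ᵐ x ∂F, 0 < x) (z : ℝ) :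
    charFun (sizeBias F) z = ∫ x : ℝ, x * Complex.exp (z * x * Complex.I) ∂F := by
  rw [charFun_apply_real, sizeBias, integral_withDensity_eq_integral_toReal_smul
    (by fun_prop) (ae_of_all _ fun _ => ENNReal.ofReal_lt_top)]
  refine integral_congr_ae ?_
  filter_upwards [hpos] with x hx
  rw [ENNReal.toReal_ofReal hx.le, Complex.real_smul]

theorem norm_exp_I_mul_sub_one_le (z x : ℝ) :
    ‖Complex.exp (Complex.I * z * x) - 1‖ ≤ |z| * |x| := by
  have := Real.norm_exp_I_mul_ofReal_sub_one_le (x := z * x)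
  rwa [Complex.ofReal_mul, ← mul_assoc, Real.norm_eq_abs, abs_mul] at this

theorem integrable_exp_sub_one {F : Measure ℝ} (h1 : Integrable (fun x : ℝ => x) F) (z : ℝ) :
    Integrable (fun x : ℝ => Complex.exp (Complex.I * z * x) - 1) F :=
  (h1.abs.const_mul |z|).mono' (by fun_prop)
    (ae_of_all _ fun x => norm_exp_I_mul_sub_one_le z x)

theorem hasDerivAt_levyExponent {F : Measure ℝ} (hpos : ∀ᵐ x ∂F, 0 < x)
    (h1 : Integrable (fun x : ℝ => x) F) (z : ℝ) :
    HasDerivAt (fun z : ℝ => ∫ x : ℝ, (Complex.exp (Complex.I * z * x) - 1) ∂F)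
      (Complex.I * charFun (sizeBias F) z) z := by
  have h := hasDerivAt_integral_of_dominated_loc_of_deriv_le (μ := F) (𝕜 := ℝ)
    (F := fun (z x : ℝ) => Complex.exp (Complex.I * z * x) - 1)
    (F' := fun (z x : ℝ) => Complex.I * (x * Complex.exp (z * x * Complex.I)))
    (x₀ := z) (s := Set.univ) (bound := fun x => |x|) Filter.univ_mem
    (Filter.Eventually.of_forall fun z => (integrable_exp_sub_one h1 z).aestronglyMeasurable)
    (integrable_exp_sub_one h1 z) (by fun_prop)
    (ae_of_all _ fun x z _ => by
      rw [norm_mul, norm_mul, Complex.norm_I, one_mul, Complex.norm_real, ← Complex.ofReal_mul,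
        Complex.norm_exp_ofReal_mul_I, mul_one, Real.norm_eq_abs])
    h1.abs
    (ae_of_all _ fun x z _ => by
      have hlin : HasDerivAt (fun z : ℝ => Complex.I * (z : ℂ) * (x : ℂ)) (Complex.I * x) z := by
        have := ((Complex.ofRealCLM.hasDerivAt (x := z)).const_mul Complex.I).mul_const (x : ℂ)
        exact this.congr_deriv (by simp)
      refine (hlin.cexp.sub_const 1).congr_deriv ?_
      rw [show Complex.I * (z : ℂ) * x = z * x * Complex.I by ring]
      ring)
  rw [charFun_sizeBias hpos, ← integral_const_mul]
  exact h.2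

/-- An `n`-th root in law of an infinitely divisible law of finite variation type has a finite
second moment. -/
theorem memLp_two_of_charFun_pow_eq {F ν : Measure ℝ} [IsProbabilityMeasure ν]
    (h1 : Integrable (fun x : ℝ => x) F) (h2 : Integrable (fun x : ℝ => x ^ 2) F) {n : ℕ}
    (hn : 1 ≤ n) (hν : ∀ z : ℝ, charFun ν z ^ n =
      Complex.exp (∫ x : ℝ, (Complex.exp (Complex.I * z * x) - 1) ∂F)) : MemLp id 2 ν := by
  refine memLp_two_of_norm_charFun_sq_ge (C := ∫ x, x ^ 2 ∂F) fun z => ?_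
  have hle := norm_charFun_le_one (μ := ν) (t := z)
  have hn1 : ‖charFun ν z‖ ^ n ≤ ‖charFun ν z‖ := by
    simpa using pow_le_pow_of_le_one (norm_nonneg _) hle hn
  have hre : -((∫ x, x ^ 2 ∂F) * z ^ 2 / 2)
      ≤ (∫ x : ℝ, (Complex.exp (Complex.I * z * x) - 1) ∂F).re := by
    rw [← RCLike.re_eq_complex_re, ← integral_re (integrable_exp_sub_one h1 z)]
    have : -((∫ x, x ^ 2 ∂F) * z ^ 2 / 2) = ∫ x, -(z ^ 2 / 2) * x ^ 2 ∂F := by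
      rw [integral_const_mul]; ring
    rw [this]
    refine integral_mono (h2.const_mul _) (integrable_exp_sub_one h1 z).re fun x => ?_
    have := Real.one_sub_sq_div_two_le_cos (x := z * x)
    have e : RCLike.re (Complex.exp (Complex.I * z * x) - 1) = Real.cos (z * x) - 1 := by
      rw [RCLike.re_eq_complex_re, Complex.sub_re, show Complex.I * (z : ℂ) * x
        = ((z * x : ℝ) : ℂ) * Complex.I by push_cast; ring, Complex.exp_ofReal_mul_I_re,
        Complex.one_re]
    rw [e]
    nlinarith
  have hnorm : ‖charFun ν z‖ ^ n
      = Real.exp (∫ x : ℝ, (Complex.exp (Complex.I * z * x) - 1) ∂F).re := by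
    rw [← norm_pow, hν, Complex.norm_exp]
  have hexp : Real.exp (-((∫ x, x ^ 2 ∂F) * z ^ 2 / 2)) ≤ ‖charFun ν z‖ :=
    (Real.exp_le_exp.2 hre).trans (hnorm ▸ hn1)
  calc 1 - (∫ x, x ^ 2 ∂F) * z ^ 2 ≤ Real.exp (-((∫ x, x ^ 2 ∂F) * z ^ 2)) := by
        linarith [Real.add_one_le_exp (-((∫ x, x ^ 2 ∂F) * z ^ 2))]
    _ = Real.exp (-((∫ x, x ^ 2 ∂F) * z ^ 2 / 2)) ^ 2 := by
        rw [← Real.exp_nat_mul]; congr 1; push_cast; ring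
    _ ≤ _ := by gcongr

theorem hasDerivAt_charFun {ν : Measure ℝ} [IsFiniteMeasure ν]
    (hi : Integrable (fun x : ℝ => x) ν) (z : ℝ) :
    HasDerivAt (charFun ν) (Complex.I * ∫ x : ℝ, x * Complex.exp (z * x * Complex.I) ∂ν) z := by
  have h1 : MemLp id (1 : ℕ) ν := by
    rw [Nat.cast_one, memLp_one_iff_integrable]; exact hi
  have hd := ((contDiff_charFun h1).differentiable (by norm_num) z).hasDerivAt
  rw [← iteratedDeriv_one, iteratedDeriv_charFun h1] at hd
  simpa using hd

/-- The size-bias identity on the level of characteristic functions: the derivative of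
`charFun ν ^ n = exp Ψ`. -/
theorem integral_mul_exp_eq {F ν : Measure ℝ} [IsProbabilityMeasure ν]
    (hpos : ∀ᵐ x ∂F, 0 < x) (h1 : Integrable (fun x : ℝ => x) F) {n : ℕ} (hn : 1 ≤ n)
    (hi : Integrable (fun x : ℝ => x) ν) (hν : ∀ z : ℝ, charFun ν z ^ n =
      Complex.exp (∫ x : ℝ, (Complex.exp (Complex.I * z * x) - 1) ∂F)) (z : ℝ) :
    n * ∫ x : ℝ, x * Complex.exp (z * x * Complex.I) ∂ν
      = charFun ν z * charFun (sizeBias F) z := by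
  have hd1 := (hasDerivAt_charFun hi z).pow n
  have hd2 := (hasDerivAt_levyExponent hpos h1 z).cexp
  have hfun : (charFun ν) ^ n = fun z : ℝ =>
      Complex.exp (∫ x : ℝ, (Complex.exp (Complex.I * z * x) - 1) ∂F) := by
    ext z; exact hν z
  rw [hfun] at hd1
  have he := hd1.unique hd2
  rw [← hν z] at he
  have hne : charFun ν z ≠ 0 := fun h0 => by
    have := hν z
    rw [h0, zero_pow (by omega)] at this
    exact Complex.exp_ne_zero _ this.symm
  obtain ⟨k, rfl⟩ : ∃ k, n = k + 1 := ⟨n - 1, by omega⟩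
  rw [Nat.add_sub_cancel, pow_succ] at he
  have hne2 : charFun ν z ^ k * Complex.I ≠ 0 := mul_ne_zero (pow_ne_zero _ hne) Complex.I_ne_zero
  refine mul_left_cancel₀ hne2 ?_
  linear_combination he

/-- The size-bias identity `n x ν(dx) = (ν ∗ x F(dx))(dx)`, together with the fact that `ν` lives
on the half line. As the negative part of `n x ν(dx)` would be a positive measure on the negative
half line that is dominated by a measure vanishing there, it is zero. -/
theorem nonneg_and_withDensity_eq_conv {F ν : Measure ℝ} [IsProbabilityMeasure ν]
    (hpos : ∀ᵐ x ∂F, 0 < x) (h1 : Integrable (fun x : ℝ => x) F) {n : ℕ} (hn : 1 ≤ n)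
    (hi : Integrable (fun x : ℝ => x) ν) (hν : ∀ z : ℝ, charFun ν z ^ n =
      Complex.exp (∫ x : ℝ, (Complex.exp (Complex.I * z * x) - 1) ∂F)) :
    (∀ᵐ x ∂ν, 0 ≤ x) ∧
      ν.withDensity (fun x => ENNReal.ofReal (n * x)) = ν ∗ sizeBias F := by
  have hfin := isFiniteMeasure_sizeBias h1
  have hnR : (0 : ℝ) < n := by exact_mod_cast hn
  set A := ν.withDensity fun x => ENNReal.ofReal (n * x) with hA
  set B := ν.withDensity fun x => ENNReal.ofReal (-(n * x)) with hB
  have hAf : IsFiniteMeasure A :=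
    isFiniteMeasure_withDensity (hi.const_mul (n : ℝ)).lintegral_lt_top.ne
  have hBf : IsFiniteMeasure B :=
    isFiniteMeasure_withDensity (hi.const_mul (n : ℝ)).neg.lintegral_lt_top.ne
  have hexp : ∀ (z : ℝ) (ξ : Measure ℝ) [IsFiniteMeasure ξ],
      Integrable (fun x : ℝ => Complex.exp (z * x * Complex.I)) ξ := fun z ξ _ =>
    Integrable.of_bound (by fun_prop) 1 (ae_of_all _ fun x => by
      rw [← Complex.ofReal_mul, Complex.norm_exp_ofReal_mul_I])
  have hsum : A = B + ν ∗ sizeBias F := by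
    apply Measure.ext_of_charFun
    ext z
    have hadd : charFun (B + ν ∗ sizeBias F) z = charFun B z + charFun (ν ∗ sizeBias F) z := by
      simp only [charFun_apply_real]
      exact integral_add_measure (hexp z B) (hexp z _)
    rw [hadd, charFun_conv, ← integral_mul_exp_eq hpos h1 hn hi hν z, ← sub_eq_iff_eq_add',
      charFun_apply_real, charFun_apply_real]
    have iA := hexp z A
    have iB := hexp z B
    rw [hA, integrable_withDensity_iff_integrable_smul' (by fun_prop)
      (ae_of_all _ fun _ => ENNReal.ofReal_lt_top)] at iA
    rw [hB, integrable_withDensity_iff_integrable_smul' (by fun_prop)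
      (ae_of_all _ fun _ => ENNReal.ofReal_lt_top)] at iB
    rw [hA, hB, integral_withDensity_eq_integral_toReal_smul (by fun_prop)
      (ae_of_all _ fun _ => ENNReal.ofReal_lt_top), integral_withDensity_eq_integral_toReal_smul
      (by fun_prop) (ae_of_all _ fun _ => ENNReal.ofReal_lt_top), ← integral_sub iA iB,
      ← integral_const_mul]
    congr 1
    ext x
    rw [← sub_smul, ENNReal.toReal_ofReal', ENNReal.toReal_ofReal', max_zero_sub_max_neg_zero_eq_self,
      Complex.real_smul]
    push_cast
    ring
  have hA0 : A (Set.Iio 0) = 0 := by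
    rw [hA, withDensity_apply_eq_zero (by fun_prop)]
    convert measure_empty (μ := ν)
    ext x
    simp only [Set.mem_inter_iff, Set.mem_ofPred_eq, Set.mem_Iio, Set.mem_empty_iff_false,
      iff_false, not_and, not_lt, ne_eq, ENNReal.ofReal_eq_zero, not_le]
    intro hx
    exact ((mul_pos_iff_of_pos_left hnR).1 hx).le
  have hB0 : B (Set.Iio 0) = 0 := by
    have : B (Set.Iio 0) ≤ A (Set.Iio 0) := by
      rw [hsum, Measure.add_apply]; exact le_self_add
    exact le_antisymm (this.trans hA0.le) bot_le
  have hnn : ∀ᵐ x ∂ν, 0 ≤ x := by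
    rw [hB, withDensity_apply_eq_zero (by fun_prop)] at hB0
    rw [ae_iff]
    convert hB0 using 2
    ext x
    simp only [Set.mem_inter_iff, Set.mem_ofPred_eq, Set.mem_Iio, ne_eq, ENNReal.ofReal_eq_zero,
      not_le]
    constructor
    · intro hx
      exact ⟨by nlinarith, hx⟩
    · exact fun h => h.2
  refine ⟨hnn, ?_⟩
  have hBz : B = 0 := by
    rw [hB, withDensity_eq_zero_iff (by fun_prop)]
    filter_upwards [hnn] with x hx
    rw [Pi.zero_apply, ENNReal.ofReal_eq_zero]
    have := mul_nonneg hnR.le hx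
    linarith
  rw [hsum, hBz, zero_add]

/-- Integrated form of the size-bias identity `n x ν(dx) = ν ∗ (x F(dx))`. -/
theorem lintegral_sizeBias {F ν : Measure ℝ} {n : ℕ} [IsFiniteMeasure (sizeBias F)]
    (h : ν.withDensity (fun x => ENNReal.ofReal (n * x)) = ν ∗ sizeBias F)
    {f : ℝ → ENNReal} (hf : Measurable f) :
    n * ∫⁻ x, ENNReal.ofReal x * f x ∂ν
      = ∫⁻ x, ∫⁻ y, ENNReal.ofReal y * f (x + y) ∂F ∂ν := by
  have h1 := lintegral_withDensity_eq_lintegral_mul ν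
    (f := fun x => ENNReal.ofReal (n * x)) (by fun_prop) hf
  rw [h, Measure.lintegral_conv hf] at h1
  have h2 : ∀ x, ∫⁻ y, f (x + y) ∂(sizeBias F) = ∫⁻ y, ENNReal.ofReal y * f (x + y) ∂F := fun x =>
    lintegral_withDensity_eq_lintegral_mul F (by fun_prop) (hf.comp (by fun_prop))
  simp_rw [h2] at h1
  rw [h1, ← lintegral_const_mul _ (by fun_prop)]
  congr 1
  ext x
  simp only [Pi.mul_apply]
  rw [ENNReal.ofReal_mul (Nat.cast_nonneg n), ENNReal.ofReal_natCast, mul_assoc]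

theorem lintegral_ofReal_pow {ν : Measure ℝ} (hnn : ∀ᵐ x ∂ν, 0 ≤ x) {j : ℕ}
    (hi : Integrable (fun x : ℝ => x ^ j) ν) :
    ∫⁻ x, ENNReal.ofReal x ^ j ∂ν = ENNReal.ofReal (∫ x, x ^ j ∂ν) := by
  rw [ofReal_integral_eq_lintegral_ofReal hi (hnn.mono fun x hx => pow_nonneg hx j)]
  exact lintegral_congr_ae (hnn.mono fun x hx => (ENNReal.ofReal_pow hx j).symm)

theorem integrable_pow_of_lintegral_ne_top {ν : Measure ℝ} (hnn : ∀ᵐ x ∂ν, 0 ≤ x) {j : ℕ}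
    (h : ∫⁻ x, ENNReal.ofReal x ^ j ∂ν ≠ ⊤) : Integrable (fun x : ℝ => x ^ j) ν := by
  refine ⟨by fun_prop, ?_⟩
  rw [hasFiniteIntegral_iff_ofReal (hnn.mono fun x hx => pow_nonneg hx j),
    lintegral_congr_ae (hnn.mono fun x hx => ENNReal.ofReal_pow hx j)]
  exact h.lt_top

/-- The first three moments of an `n`-th root in law of the infinitely divisible law with Lévy
measure `F` on `(0, ∞)`, in terms of the moments of `F`. -/
theorem moments_of_charFun_pow_eq {F ν : Measure ℝ} [IsProbabilityMeasure ν]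
    (hpos : ∀ᵐ x ∂F, 0 < x) (h1 : Integrable (fun x : ℝ => x ^ 1) F)
    (h2 : Integrable (fun x : ℝ => x ^ 2) F) (h3 : Integrable (fun x : ℝ => x ^ 3) F) {n : ℕ}
    (hn : 1 ≤ n) (hν : ∀ z : ℝ, charFun ν z ^ n =
      Complex.exp (∫ x : ℝ, (Complex.exp (Complex.I * z * x) - 1) ∂F)) :
    (∀ᵐ x ∂ν, 0 ≤ x) ∧ MemLp id 3 ν ∧ n * ∫ x, x ∂ν = ∫ x, x ^ 1 ∂F ∧
      n * ∫ x, x ^ 2 ∂ν = (∫ x, x ∂ν) * (∫ x, x ^ 1 ∂F) + ∫ x, x ^ 2 ∂F ∧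
      n * ∫ x, x ^ 3 ∂ν = (∫ x, x ^ 2 ∂ν) * (∫ x, x ^ 1 ∂F) + 2 * (∫ x, x ∂ν) * (∫ x, x ^ 2 ∂F)
        + ∫ x, x ^ 3 ∂F := by
  have h1' : Integrable (fun x : ℝ => x) F := by simpa using h1
  have hL2 := memLp_two_of_charFun_pow_eq h1' h2 hn hν
  have hi : Integrable (fun x : ℝ => x) ν := hL2.integrable (by norm_num)
  have j1 : Integrable (fun x : ℝ => x ^ 1) ν := by simpa using hi
  have j2 : Integrable (fun x : ℝ => x ^ 2) ν := by simpa using hL2.integrable_sq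
  obtain ⟨hnn, hsb⟩ := nonneg_and_withDensity_eq_conv hpos h1' hn hi hν
  have hfin := isFiniteMeasure_sizeBias h1'
  have hpos' : ∀ᵐ x ∂F, 0 ≤ x := hpos.mono fun x hx => hx.le
  have k1 := lintegral_ofReal_pow hpos' h1
  have k2 := lintegral_ofReal_pow hpos' h2
  have k3 := lintegral_ofReal_pow hpos' h3
  have m1 := lintegral_ofReal_pow hnn j1
  have m2 := lintegral_ofReal_pow hnn j2
  have q1 : 0 ≤ ∫ x, x ^ 1 ∂F := integral_nonneg_of_ae (hpos'.mono fun x hx => pow_nonneg hx 1)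
  have q2 : 0 ≤ ∫ x, x ^ 2 ∂F := integral_nonneg_of_ae (hpos'.mono fun x hx => pow_nonneg hx 2)
  have q3 : 0 ≤ ∫ x, x ^ 3 ∂F := integral_nonneg_of_ae (hpos'.mono fun x hx => pow_nonneg hx 3)
  have p1 : 0 ≤ ∫ x, x ^ 1 ∂ν := integral_nonneg_of_ae (hnn.mono fun x hx => pow_nonneg hx 1)
  have p2 : 0 ≤ ∫ x, x ^ 2 ∂ν := integral_nonneg_of_ae (hnn.mono fun x hx => pow_nonneg hx 2)
  have p3 : 0 ≤ ∫ x, x ^ 3 ∂ν := integral_nonneg_of_ae (hnn.mono fun x hx => pow_nonneg hx 3)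
  have e1 : (n : ENNReal) * ∫⁻ x, ENNReal.ofReal x ^ 1 ∂ν = ENNReal.ofReal (∫ x, x ^ 1 ∂F) := by
    have h := lintegral_sizeBias hsb (f := fun _ => 1) measurable_const
    simp only [mul_one, lintegral_const, measure_univ] at h
    rw [← k1]
    simpa only [pow_one] using h
  have e2 : (n : ENNReal) * ∫⁻ x, ENNReal.ofReal x ^ 2 ∂ν = ENNReal.ofReal
      ((∫ x, x ^ 1 ∂ν) * (∫ x, x ^ 1 ∂F) + ∫ x, x ^ 2 ∂F) := by
    have h := lintegral_sizeBias hsb (f := fun x => ENNReal.ofReal x) (by fun_prop)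
    have hin : ∀ᵐ x ∂ν, ∫⁻ y, ENNReal.ofReal y * ENNReal.ofReal (x + y) ∂F
        = ENNReal.ofReal x ^ 1 * ENNReal.ofReal (∫ x, x ^ 1 ∂F)
          + ENNReal.ofReal (∫ x, x ^ 2 ∂F) := by
      filter_upwards [hnn] with x hx
      rw [← k1, ← k2, ← lintegral_const_mul _ (by fun_prop), ← lintegral_add_left (by fun_prop)]
      refine lintegral_congr_ae (hpos'.mono fun y hy => ?_)
      simp only
      rw [ENNReal.ofReal_add hx hy]
      ring
    rw [lintegral_congr_ae hin, lintegral_add_left (by fun_prop),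
      lintegral_mul_const _ (by fun_prop), m1, lintegral_const, measure_univ, mul_one,
      ← ENNReal.ofReal_mul p1, ← ENNReal.ofReal_add (by positivity) q2] at h
    rw [← h]
    simp only [sq]
  have e3 : (n : ENNReal) * ∫⁻ x, ENNReal.ofReal x ^ 3 ∂ν = ENNReal.ofReal
      ((∫ x, x ^ 2 ∂ν) * (∫ x, x ^ 1 ∂F) + 2 * (∫ x, x ^ 1 ∂ν) * (∫ x, x ^ 2 ∂F)
        + ∫ x, x ^ 3 ∂F) := by
    have h := lintegral_sizeBias hsb (f := fun x => ENNReal.ofReal x ^ 2) (by fun_prop)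
    have hin : ∀ᵐ x ∂ν, ∫⁻ y, ENNReal.ofReal y * ENNReal.ofReal (x + y) ^ 2 ∂F
        = ENNReal.ofReal x ^ 2 * ENNReal.ofReal (∫ x, x ^ 1 ∂F)
          + ENNReal.ofReal x ^ 1 * ENNReal.ofReal (2 * ∫ x, x ^ 2 ∂F)
          + ENNReal.ofReal (∫ x, x ^ 3 ∂F) := by
      filter_upwards [hnn] with x hx
      rw [ENNReal.ofReal_mul zero_le_two, ENNReal.ofReal_ofNat, ← k1, ← k2, ← k3,
        ← lintegral_const_mul _ (by fun_prop), ← lintegral_const_mul _ (by fun_prop),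
        ← lintegral_const_mul _ (by fun_prop), ← lintegral_add_left (by fun_prop),
        ← lintegral_add_left (by fun_prop)]
      refine lintegral_congr_ae (hpos'.mono fun y hy => ?_)
      simp only
      rw [ENNReal.ofReal_add hx hy]
      ring
    rw [lintegral_congr_ae hin, lintegral_add_left (by fun_prop), lintegral_add_left (by fun_prop),
      lintegral_mul_const _ (by fun_prop), lintegral_mul_const _ (by fun_prop), m1, m2,
      lintegral_const, measure_univ, mul_one, ← ENNReal.ofReal_mul p1, ← ENNReal.ofReal_mul p2,
      ← ENNReal.ofReal_add (by positivity) (by positivity),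
      ← ENNReal.ofReal_add (by positivity) q3] at h
    rw [show 2 * (∫ x, x ^ 1 ∂ν) * (∫ x, x ^ 2 ∂F) = (∫ x, x ^ 1 ∂ν) * (2 * ∫ x, x ^ 2 ∂F) by ring,
      ← h]
    congr 2
    ext x
    ring
  have j3 : Integrable (fun x : ℝ => x ^ 3) ν := by
    refine integrable_pow_of_lintegral_ne_top hnn fun htop => ?_
    rw [htop, ENNReal.mul_top (by simp; omega)] at e3
    exact ENNReal.ofReal_ne_top e3.symm
  have m3 := lintegral_ofReal_pow hnn j3
  rw [m1, ← ENNReal.ofReal_natCast n, ← ENNReal.ofReal_mul (by positivity),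
    ENNReal.ofReal_eq_ofReal_iff (by positivity) (by positivity)] at e1
  rw [m2, ← ENNReal.ofReal_natCast n, ← ENNReal.ofReal_mul (by positivity),
    ENNReal.ofReal_eq_ofReal_iff (by positivity) (by positivity)] at e2
  rw [m3, ← ENNReal.ofReal_natCast n, ← ENNReal.ofReal_mul (by positivity),
    ENNReal.ofReal_eq_ofReal_iff (by positivity) (by positivity)] at e3
  have hx1 : ∫ x, x ^ 1 ∂ν = ∫ x, x ∂ν := by simp
  rw [hx1] at e1 e2 e3
  refine ⟨hnn, ?_, e1, e2, e3⟩
  have habs : Integrable (fun x : ℝ => ‖id x‖ ^ 3) ν := by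
    simpa [abs_pow] using j3.abs
  exact (integrable_norm_rpow_iff (by fun_prop) (by norm_num) (by norm_num)).1
    (by simpa using habs)

/-! ### Tempered stable laws -/

theorem ae_pos_tsLevyMeasure (α β lam : ℝ) : ∀ᵐ x ∂(tsLevyMeasure α β lam), 0 < x :=
  (withDensity_absolutelyContinuous _ _).ae_le (ae_restrict_mem measurableSet_Ioi)

theorem tsLevyMeasure_density_mul_pow {α β lam x : ℝ} (hα : 0 < α) (hx : 0 < x) (k : ℕ) :
    (ENNReal.ofReal (α / x ^ (1 + β) * Real.exp (-lam * x))).toReal * x ^ k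
      = α * (x ^ ((k : ℝ) - β - 1) * Real.exp (-(lam * x))) := by
  rw [ENNReal.toReal_ofReal (by positivity)]
  have h : x ^ ((k : ℝ) - β - 1) = x ^ k / x ^ (1 + β) := by
    rw [← Real.rpow_natCast x k, ← Real.rpow_sub hx]
    congr 1
    ring
  rw [h, neg_mul]
  ring

theorem integrable_pow_tsLevyMeasure {α β lam : ℝ} (hα : 0 < α) (hβ : β < 1) (hlam : 0 < lam)
    {k : ℕ} (hk : 1 ≤ k) : Integrable (fun x : ℝ => x ^ k) (tsLevyMeasure α β lam) := by
  have hkR : (1 : ℝ) ≤ k := by exact_mod_cast hk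
  rw [tsLevyMeasure, integrable_withDensity_iff_integrable_smul' (by fun_prop)
    (ae_of_all _ fun _ => ENNReal.ofReal_lt_top)]
  have h := integrableOn_rpow_mul_exp_neg_mul_rpow (p := 1) (s := (k : ℝ) - β - 1) (b := lam)
    (by linarith) one_pos hlam
  have h' := h.const_mul α
  refine h'.congr ?_
  filter_upwards [ae_restrict_mem measurableSet_Ioi] with x hx
  rw [smul_eq_mul, tsLevyMeasure_density_mul_pow hα hx, Real.rpow_one, neg_mul]

theorem integral_pow_tsLevyMeasure {α β lam : ℝ} (hα : 0 < α) (hβ : β < 1) (hlam : 0 < lam)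
    {k : ℕ} (hk : 1 ≤ k) : ∫ x, x ^ k ∂(tsLevyMeasure α β lam)
      = α * ((1 / lam) ^ ((k : ℝ) - β) * Real.Gamma (k - β)) := by
  have hkR : (1 : ℝ) ≤ k := by exact_mod_cast hk
  rw [tsLevyMeasure, integral_withDensity_eq_integral_toReal_smul (by fun_prop)
    (ae_of_all _ fun _ => ENNReal.ofReal_lt_top),
    ← Real.integral_rpow_mul_exp_neg_mul_Ioi (by linarith) hlam, ← integral_const_mul]
  refine setIntegral_congr_fun measurableSet_Ioi fun x hx => ?_
  simp only [smul_eq_mul]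
  exact tsLevyMeasure_density_mul_pow hα hx k

theorem integral_pow_succ_tsLevyMeasure {α β lam : ℝ} (hα : 0 < α) (hβ : β < 1) (hlam : 0 < lam)
    {k : ℕ} (hk : 1 ≤ k) : ∫ x, x ^ (k + 1) ∂(tsLevyMeasure α β lam)
      = (k - β) / lam * ∫ x, x ^ k ∂(tsLevyMeasure α β lam) := by
  have hkR : (1 : ℝ) ≤ k := by exact_mod_cast hk
  rw [integral_pow_tsLevyMeasure hα hβ hlam hk, integral_pow_tsLevyMeasure hα hβ hlam (by omega)]
  have e : ((k + 1 : ℕ) : ℝ) - β = (k - β) + 1 := by push_cast; ring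
  rw [e, Real.Gamma_add_one (by linarith), Real.rpow_add (by positivity), Real.rpow_one]
  ring

theorem integral_pow_tsLevyMeasure_pos {α β lam : ℝ} (hα : 0 < α) (hβ : β < 1) (hlam : 0 < lam)
    {k : ℕ} (hk : 1 ≤ k) : 0 < ∫ x, x ^ k ∂(tsLevyMeasure α β lam) := by
  have hkR : (1 : ℝ) ≤ k := by exact_mod_cast hk
  rw [integral_pow_tsLevyMeasure hα hβ hlam hk]
  have := Real.Gamma_pos_of_pos (by linarith : 0 < (k : ℝ) - β)
  positivity

/-- The mean, the variance and the third moment of an `n`-th convolution root of a one-sided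
tempered stable law; the third moment is `∫ x ^ 3 F(dx) / n` up to an error of order `n⁻²`. -/
theorem IsOneSidedTS.moments_root {α β lam : ℝ} {η ν : Measure ℝ} (h : IsOneSidedTS α β lam η)
    (hα : 0 < α) (hβ : β < 1) (hlam : 0 < lam) [IsProbabilityMeasure ν] {n : ℕ} (hn : 1 ≤ n)
    (hν : iidSumLaw ν n = η) :
    (∀ᵐ x ∂ν, 0 ≤ x) ∧ MemLp id 3 ν ∧
      n * ∫ x, x ∂ν = ∫ x, x ^ 1 ∂(tsLevyMeasure α β lam) ∧
      n * (∫ x, x ^ 2 ∂ν - (∫ x, x ∂ν) ^ 2) = ∫ x, x ^ 2 ∂(tsLevyMeasure α β lam) ∧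
      n * ∫ x, x ^ 3 ∂ν ≤ ∫ x, x ^ 3 ∂(tsLevyMeasure α β lam)
        + (3 * (∫ x, x ^ 1 ∂(tsLevyMeasure α β lam)) * (∫ x, x ^ 2 ∂(tsLevyMeasure α β lam))
          + (∫ x, x ^ 1 ∂(tsLevyMeasure α β lam)) ^ 3) / n := by
  obtain ⟨hnn, h3, e1, e2, e3⟩ := moments_of_charFun_pow_eq (ν := ν) (n := n)
    (ae_pos_tsLevyMeasure α β lam) (integrable_pow_tsLevyMeasure hα hβ hlam le_rfl)
    (integrable_pow_tsLevyMeasure hα hβ hlam one_le_two)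
    (integrable_pow_tsLevyMeasure hα hβ hlam (by norm_num)) hn
    (fun z => by rw [← charFun_iidSumLaw, hν, h.charFun_eq])
  have p1 := integral_pow_tsLevyMeasure_pos hα hβ hlam (le_refl 1)
  have p2 := integral_pow_tsLevyMeasure_pos hα hβ hlam one_le_two
  set κ₁ := ∫ x, x ^ 1 ∂(tsLevyMeasure α β lam)
  set κ₂ := ∫ x, x ^ 2 ∂(tsLevyMeasure α β lam)
  set κ₃ := ∫ x, x ^ 3 ∂(tsLevyMeasure α β lam)
  have hnR : (1 : ℝ) ≤ n := by exact_mod_cast hn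
  have hn0 : (0 : ℝ) < n := by linarith
  refine ⟨hnn, h3, e1, ?_, ?_⟩
  · linear_combination e2 - (∫ x, x ∂ν) * e1
  · have f1 : ∫ x, x ∂ν = κ₁ / n := by rw [← e1]; field_simp
    rw [f1] at e2 e3
    have f2 : ∫ x, x ^ 2 ∂ν = (κ₁ / n * κ₁ + κ₂) / n := by rw [← e2]; field_simp
    rw [f2] at e3
    rw [e3]
    have f3 : κ₁ / n ≤ κ₁ := div_le_self p1.le hnR
    have f4 : (κ₁ / n * κ₁ + κ₂) / n * κ₁ ≤ (κ₁ * κ₁ + κ₂) / n * κ₁ := by gcongr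
    have f5 : (3 * κ₁ * κ₂ + κ₁ ^ 3) / n = (κ₁ * κ₁ + κ₂) / n * κ₁ + 2 * (κ₁ / n) * κ₂ := by ring
    rw [f5]
    linarith

/-! ### Differences of independent nonnegative variables -/

theorem conv_map_neg_eq_map_prod (ν ξ : Measure ℝ) [IsProbabilityMeasure ν]
    [IsProbabilityMeasure ξ] :
    ν ∗ ξ.map (fun x => -x) = (ν.prod ξ).map (fun p => p.1 - p.2) := by
  have h := Measure.map_prod_map ν ξ measurable_id (measurable_neg (G := ℝ))
  rw [Measure.map_id] at h
  rw [Measure.conv, show (fun x : ℝ => -x) = Neg.neg from rfl, h,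
    Measure.map_map (by fun_prop) (by fun_prop)]
  congr 1

/-- Moments of the difference of two independent nonnegative random variables with laws
`ν` and `ξ`. -/
theorem moments_conv_map_neg {ν ξ : Measure ℝ} [IsProbabilityMeasure ν] [IsProbabilityMeasure ξ]
    (hν : ∀ᵐ x ∂ν, 0 ≤ x) (hξ : ∀ᵐ x ∂ξ, 0 ≤ x) (hν3 : MemLp id 3 ν) (hξ3 : MemLp id 3 ξ) :
    MemLp id 3 (ν ∗ ξ.map (fun x => -x)) ∧
      ∫ z, z ∂(ν ∗ ξ.map (fun x => -x)) = ∫ x, x ∂ν - ∫ y, y ∂ξ ∧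
      Var[id; ν ∗ ξ.map (fun x => -x)]
        = (∫ x, x ^ 2 ∂ν - (∫ x, x ∂ν) ^ 2) + (∫ y, y ^ 2 ∂ξ - (∫ y, y ∂ξ) ^ 2) ∧
      ∫ z, |z| ^ 3 ∂(ν ∗ ξ.map (fun x => -x)) ≤ ∫ x, x ^ 3 ∂ν + ∫ y, y ^ 3 ∂ξ := by
  have moments : ∀ (ν : Measure ℝ) [IsProbabilityMeasure ν], MemLp id 3 ν →
      Integrable (fun x : ℝ => x) ν ∧ Integrable (fun x : ℝ => x ^ 2) ν ∧
      Integrable (fun x : ℝ => x ^ 3) ν := fun ν _ h => by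
    refine ⟨h.integrable (by norm_num), ?_, ?_⟩
    · simpa using (h.mono_exponent (p := 2) (by norm_num)).integrable_sq
    · have : Integrable (fun x : ℝ => ‖id x‖ ^ 3) ν := h.integrable_norm_pow'
      refine this.mono' (by fun_prop) (ae_of_all _ fun x => ?_)
      simp
  obtain ⟨a1, a2, a3⟩ := moments ν hν3
  obtain ⟨b1, b2, b3⟩ := moments ξ hξ3
  have c1 : ∀ {f : ℝ → ℝ}, ∫ p, f p.1 ∂(ν.prod ξ) = ∫ x, f x ∂ν := fun {f} => by
    have := integral_fun_fst (μ := ν) (ν := ξ) f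
    simpa using this
  have c2 : ∀ {f : ℝ → ℝ}, ∫ p, f p.2 ∂(ν.prod ξ) = ∫ y, f y ∂ξ := fun {f} => by
    have := integral_fun_snd (μ := ν) (ν := ξ) f
    simpa using this
  have hL3 : MemLp (fun p : ℝ × ℝ => p.1 - p.2) 3 (ν.prod ξ) :=
    (hν3.comp_fst ξ).sub (hξ3.comp_snd ν)
  have hmem : MemLp id 3 (ν ∗ ξ.map (fun x => -x)) := by
    rw [conv_map_neg_eq_map_prod, memLp_map_measure_iff (by fun_prop) (by fun_prop)]
    exact hL3
  have hpr : IsProbabilityMeasure (ξ.map (fun x => -x)) :=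
    Measure.isProbabilityMeasure_map (by fun_prop)
  have hmean : ∫ z, z ∂(ν ∗ ξ.map (fun x => -x)) = ∫ x, x ∂ν - ∫ y, y ∂ξ := by
    rw [conv_map_neg_eq_map_prod, integral_map (by fun_prop) (by fun_prop),
      integral_sub (a1.comp_fst ξ) (b1.comp_snd ν), c1 (f := fun x => x), c2 (f := fun x => x)]
  refine ⟨hmem, hmean, ?_, ?_⟩
  · rw [variance_eq_sub (hmem.mono_exponent (p := 2) (by norm_num))]
    have hsq : ∫ z, z ^ 2 ∂(ν ∗ ξ.map (fun x => -x))
        = ∫ x, x ^ 2 ∂ν - 2 * ((∫ x, x ∂ν) * ∫ y, y ∂ξ) + ∫ y, y ^ 2 ∂ξ := by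
      rw [conv_map_neg_eq_map_prod, integral_map (by fun_prop) (by fun_prop)]
      have : ∀ p : ℝ × ℝ, (p.1 - p.2) ^ 2 = p.1 ^ 2 - 2 * (p.1 * p.2) + p.2 ^ 2 :=
        fun p => by ring
      simp_rw [this]
      have i12 : Integrable (fun p : ℝ × ℝ => 2 * (p.1 * p.2)) (ν.prod ξ) :=
        (a1.mul_prod b1).const_mul 2
      have i112 : Integrable (fun p : ℝ × ℝ => p.1 ^ 2 - 2 * (p.1 * p.2)) (ν.prod ξ) :=
        (a2.comp_fst ξ).sub i12
      rw [integral_add i112 (b2.comp_snd ν),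
        integral_sub (a2.comp_fst ξ) i12, integral_const_mul,
        integral_prod_mul (fun x : ℝ => x) (fun y : ℝ => y), c1 (f := fun x => x ^ 2),
        c2 (f := fun x => x ^ 2)]
    have e1 : (∫ z, (id ^ 2 : ℝ → ℝ) z ∂(ν ∗ ξ.map (fun x => -x)))
        = ∫ z, z ^ 2 ∂(ν ∗ ξ.map (fun x => -x)) := rfl
    have e2 : (∫ z, id z ∂(ν ∗ ξ.map (fun x => -x)))
        = ∫ z, z ∂(ν ∗ ξ.map (fun x => -x)) := rfl
    rw [e1, e2, hsq, hmean]
    ring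
  · rw [conv_map_neg_eq_map_prod, integral_map (by fun_prop) (by fun_prop),
      ← c1 (f := fun x => x ^ 3), ← c2 (f := fun x => x ^ 3),
      ← integral_add (a3.comp_fst ξ) (b3.comp_snd ν)]
    refine integral_mono_ae (by simpa using hL3.integrable_norm_pow')
      ((a3.comp_fst ξ).add (b3.comp_snd ν)) ?_
    have h1 : ∀ᵐ p ∂(ν.prod ξ), 0 ≤ p.1 := Measure.quasiMeasurePreserving_fst.ae hν
    have h2 : ∀ᵐ p ∂(ν.prod ξ), 0 ≤ p.2 := Measure.quasiMeasurePreserving_snd.ae hξ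
    filter_upwards [h1, h2] with p hp1 hp2
    rcases le_total p.1 p.2 with hle | hle
    · have : |p.1 - p.2| ≤ p.2 := by rw [abs_le]; constructor <;> linarith
      have := pow_le_pow_left₀ (abs_nonneg _) this 3
      linarith [pow_nonneg hp1 3]
    · have : |p.1 - p.2| ≤ p.1 := by rw [abs_le]; constructor <;> linarith
      have := pow_le_pow_left₀ (abs_nonneg _) this 3
      linarith [pow_nonneg hp2 3]

theorem integral_abs_sub_pow_three_le {ζ : Measure ℝ} [IsProbabilityMeasure ζ]
    (h : MemLp id 3 ζ) (m : ℝ) :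
    ∫ y, |y - m| ^ 3 ∂ζ ≤ 4 * (∫ y, |y| ^ 3 ∂ζ + |m| ^ 3) := by
  have i1 : Integrable (fun y : ℝ => |y| ^ 3) ζ := by simpa using h.integrable_norm_pow'
  have i2 : Integrable (fun y : ℝ => |y - m| ^ 3) ζ := by
    simpa using (h.sub (memLp_const m)).integrable_norm_pow'
  have e : 4 * (∫ y, |y| ^ 3 ∂ζ + |m| ^ 3) = ∫ y, 4 * (|y| ^ 3 + |m| ^ 3) ∂ζ := by
    rw [integral_const_mul, integral_add i1 (integrable_const _)]
    simp
  rw [e]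
  refine integral_mono i2 ((i1.add (integrable_const _)).const_mul 4) fun y => ?_
  have h1 : |y - m| ^ 3 ≤ (|y| + |m|) ^ 3 := by gcongr; exact abs_sub y m
  refine h1.trans ?_
  have ha := abs_nonneg y
  have hb := abs_nonneg m
  nlinarith [mul_nonneg (add_nonneg ha hb) (sq_nonneg (|y| - |m|))]

/-! ### Normal approximation of tempered stable laws -/

/-- Berry–Esseen bound for a law with an `n`-th convolution root `ζ`, in terms of the mean `m` and the
standard deviation `σ` of that law. -/
theorem IsBerryEsseenBound.abs_cdf_sub_le {c : ℝ} (hc : IsBerryEsseenBound c) {ζ : Measure ℝ}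
    [IsProbabilityMeasure ζ] (h3 : MemLp id 3 ζ) {n : ℕ} (hn : 1 ≤ n) {m σ : ℝ} (hσ : 0 < σ)
    (hm : n * ∫ y, y ∂ζ = m) (hv : n * Var[id; ζ] = σ ^ 2) (x : ℝ) :
    |cdf (iidSumLaw ζ n) x - cdf (gaussianReal m (σ ^ 2).toNNReal) x|
      ≤ c * (n * ∫ y, |y - m / n| ^ 3 ∂ζ) / σ ^ 3 := by
  have hnR : (0 : ℝ) < n := by exact_mod_cast hn
  have hsn : 0 < √(n : ℝ) := Real.sqrt_pos.2 hnR
  have hsn2 : √(n : ℝ) ^ 2 = n := Real.sq_sqrt hnR.le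
  have hmn : m / n = ∫ y, y ∂ζ := by rw [← hm]; field_simp
  have hs : σ / √(n : ℝ) = √(Var[id; ζ]) := by
    have : Var[id; ζ] = (σ / √(n : ℝ)) ^ 2 := by
      rw [div_pow, hsn2, ← hv]; field_simp
    rw [this, Real.sqrt_sq (by positivity)]
  have h := hc ζ inferInstance h3 (m / n) (σ / √(n : ℝ)) hmn hs (by positivity) n hn ((x - m) / σ)
  have e1 : (n : ℝ) * (m / n) = m := by field_simp
  have e2 : σ / √(n : ℝ) * √(n : ℝ) = σ := by field_simp
  have e3 : m + σ * ((x - m) / σ) = x := by field_simp; ring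
  rw [e1, e2, cdf_map_div_sub _ _ hσ, e3] at h
  have hN : (gaussianReal m (σ ^ 2).toNNReal).map (fun y => (y - m) / σ) = gaussianReal 0 1 := by
    have h1 := gaussianReal_map_sub_const (μ := m) (v := (σ ^ 2).toNNReal) m
    have h2 := gaussianReal_map_div_const (μ := m - m) (v := (σ ^ 2).toNNReal) σ
    rw [← h1, Measure.map_map (by fun_prop) (by fun_prop)] at h2
    have h3 : (fun y => (y - m) / σ) = (fun x => x / σ) ∘ fun x => x - m := rfl
    rw [h3, h2]
    congr 1
    · simp
    · ext
      simp [Real.coe_toNNReal _ (sq_nonneg σ), hσ.ne']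
  have hG := cdf_map_div_sub (gaussianReal m (σ ^ 2).toNNReal) m hσ ((x - m) / σ)
  rw [hN, e3] at hG
  rw [hG] at h
  refine h.trans (le_of_eq ?_)
  have e4 : (σ / √(n : ℝ)) ^ 3 * √(n : ℝ) = σ ^ 3 / n := by
    rw [div_pow]
    nth_rewrite 3 [← hsn2]
    field_simp
  rw [e4, div_div_eq_mul_div]
  ring

theorem iidSumLaw_conv_map_neg (ν ξ : Measure ℝ) [IsProbabilityMeasure ν]
    [IsProbabilityMeasure ξ] (n : ℕ) :
    iidSumLaw (ν ∗ ξ.map (fun x => -x)) n = iidSumLaw ν n ∗ (iidSumLaw ξ n).map (fun x => -x) := by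
  have hpr : IsProbabilityMeasure (ξ.map (fun x => -x)) :=
    Measure.isProbabilityMeasure_map (by fun_prop)
  rw [iidSumLaw_conv, iidSumLaw_map_neg]

/-- The mean and the variance of a two-sided tempered stable law, and the normal approximation in
terms of the third absolute moment of its Lévy measure. -/
theorem normal_approximation_of_isOneSidedTS {αp βp lp αm βm lm : ℝ} {ηp ηm : Measure ℝ}
    (hp : IsOneSidedTS αp βp lp ηp) (hm : IsOneSidedTS αm βm lm ηm)
    (hαp : 0 < αp) (hβp : βp < 1) (hlp : 0 < lp) (hαm : 0 < αm) (hβm : βm < 1) (hlm : 0 < lm) :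
    MemLp id 3 (ηp ∗ ηm.map (fun x => -x)) ∧
      ∫ x, x ∂(ηp ∗ ηm.map (fun x => -x))
        = ∫ x, x ^ 1 ∂(tsLevyMeasure αp βp lp) - ∫ x, x ^ 1 ∂(tsLevyMeasure αm βm lm) ∧
      Var[id; ηp ∗ ηm.map (fun x => -x)]
        = ∫ x, x ^ 2 ∂(tsLevyMeasure αp βp lp) + ∫ x, x ^ 2 ∂(tsLevyMeasure αm βm lm) ∧
      ∀ c : ℝ, IsBerryEsseenBound c → ∀ m σ : ℝ, m = ∫ x, x ∂(ηp ∗ ηm.map (fun x => -x)) →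
        0 < σ → σ ^ 2 = Var[id; ηp ∗ ηm.map (fun x => -x)] → ∀ x,
        |cdf (ηp ∗ ηm.map (fun x => -x)) x - cdf (gaussianReal m (σ ^ 2).toNNReal) x|
          ≤ 4 * c * (∫ x, x ^ 3 ∂(tsLevyMeasure αp βp lp)
            + ∫ x, x ^ 3 ∂(tsLevyMeasure αm βm lm)) / σ ^ 3 := by
  have := hp.isProbabilityMeasure
  have := hm.isProbabilityMeasure
  obtain ⟨u1, u2, u3, u4, -⟩ := hp.moments_root hαp hβp hlp le_rfl (iidSumLaw_one ηp)
  obtain ⟨v1, v2, v3, v4, -⟩ := hm.moments_root hαm hβm hlm le_rfl (iidSumLaw_one ηm)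
  obtain ⟨w1, w2, w3, -⟩ := moments_conv_map_neg u1 v1 u2 v2
  rw [Nat.cast_one, one_mul] at u3 u4 v3 v4
  rw [u3, v3] at w2
  rw [u4, v4] at w3
  refine ⟨w1, w2, w3, fun c hc m σ hmm hσ hσv x => ?_⟩
  rw [w2] at hmm
  rw [w3] at hσv
  set p₁ := ∫ x, x ^ 1 ∂(tsLevyMeasure αp βp lp)
  set p₂ := ∫ x, x ^ 2 ∂(tsLevyMeasure αp βp lp)
  set p₃ := ∫ x, x ^ 3 ∂(tsLevyMeasure αp βp lp)
  set q₁ := ∫ x, x ^ 1 ∂(tsLevyMeasure αm βm lm)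
  set q₂ := ∫ x, x ^ 2 ∂(tsLevyMeasure αm βm lm)
  set q₃ := ∫ x, x ^ 3 ∂(tsLevyMeasure αm βm lm)
  set R := (3 * p₁ * p₂ + p₁ ^ 3) + (3 * q₁ * q₂ + q₁ ^ 3) + |m| ^ 3 with hR
  -- The estimate with the `n`-th convolution root, whose error term vanishes as `n → ∞`.
  have key : ∀ n : ℕ, 1 ≤ n →
      |cdf (ηp ∗ ηm.map (fun x => -x)) x - cdf (gaussianReal m (σ ^ 2).toNNReal) x|
        ≤ c * (4 * (p₃ + q₃ + R * (1 / (n : ℝ)))) / σ ^ 3 := by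
    intro n hn
    have hnR : (1 : ℝ) ≤ n := by exact_mod_cast hn
    have hn0 : (0 : ℝ) < n := by linarith
    obtain ⟨ν, hνp, hν⟩ := hp.isInfinitelyDivisible n hn
    obtain ⟨ξ, hξp, hξ⟩ := hm.isInfinitelyDivisible n hn
    obtain ⟨u1, u2, u3, u4, u5⟩ := hp.moments_root hαp hβp hlp hn hν
    obtain ⟨v1, v2, v3, v4, v5⟩ := hm.moments_root hαm hβm hlm hn hξ
    obtain ⟨w1, w2, w3, w4⟩ := moments_conv_map_neg u1 v1 u2 v2
    have hpr : IsProbabilityMeasure (ξ.map (fun x => -x)) :=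
      Measure.isProbabilityMeasure_map (by fun_prop)
    have hb := hc.abs_cdf_sub_le w1 hn hσ (m := m)
      (by rw [w2, mul_sub, u3, v3, hmm]) (by rw [w3, mul_add, u4, v4, hσv]) x
    rw [iidSumLaw_conv_map_neg, hν, hξ] at hb
    refine hb.trans ?_
    refine div_le_div_of_nonneg_right (mul_le_mul_of_nonneg_left ?_ hc.nonneg) (by positivity)
    have h1 := integral_abs_sub_pow_three_le w1 (m / n)
    have h2 : n * |m / n| ^ 3 ≤ |m| ^ 3 * (1 / n) := by
      rw [abs_div, abs_of_pos hn0, div_pow]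
      have h3 : (n : ℝ) * (|m| ^ 3 / n ^ 3) = |m| ^ 3 * (1 / n) * (1 / n) := by
        field_simp
      rw [h3]
      exact mul_le_of_le_one_right (by positivity) ((div_le_one hn0).2 hnR)
    calc (n : ℝ) * ∫ y, |y - m / n| ^ 3 ∂(ν ∗ ξ.map fun x => -x)
        ≤ n * (4 * ((∫ x, x ^ 3 ∂ν + ∫ y, y ^ 3 ∂ξ) + |m / n| ^ 3)) := by
          gcongr
          exact h1.trans (by gcongr)
      _ = 4 * (n * ∫ x, x ^ 3 ∂ν + n * ∫ y, y ^ 3 ∂ξ + n * |m / n| ^ 3) := by ring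
      _ ≤ 4 * ((p₃ + (3 * p₁ * p₂ + p₁ ^ 3) / n) + (q₃ + (3 * q₁ * q₂ + q₁ ^ 3) / n)
          + |m| ^ 3 * (1 / n)) := by gcongr
      _ = _ := by rw [hR]; ring
  have hlim : Filter.Tendsto (fun n : ℕ => c * (4 * (p₃ + q₃ + R * (1 / (n : ℝ)))) / σ ^ 3)
      Filter.atTop (nhds (c * (4 * (p₃ + q₃ + R * 0)) / σ ^ 3)) :=
    ((((tendsto_one_div_atTop_nhds_zero_nat (𝕜 := ℝ)).const_mul R).const_add _).const_mul 4
      |>.const_mul c).div_const _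
  have hfin := ge_of_tendsto hlim (Filter.eventually_atTop.2 ⟨1, key⟩)
  refine hfin.trans (le_of_eq ?_)
  ring

/-- The moments of the Lévy measure expressed through the mean and the variance: with
`a = ∫ x F⁺(dx)` and `b = ∫ x F⁻(dx)`, the mean is `a - b` and the variance is
`(1 - β⁺) a / λ⁺ + (1 - β⁻) b / λ⁻`, and these two equations are solved for `a` and `b`. -/
theorem third_moment_eq_bracket {a b βp βm lp lm μ σ : ℝ} (hβp : βp < 1) (hβm : βm < 1)
    (hlp : 0 < lp) (hlm : 0 < lm) (hσ : 0 < σ) (hμ : μ = a - b)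
    (hσ2 : σ ^ 2 = (1 - βp) / lp * a + (1 - βm) / lm * b) :
    ((2 - βp) / lp * ((1 - βp) / lp * a) + (2 - βm) / lm * ((1 - βm) / lm * b)) / σ ^ 3
      = (1 - βp) * (2 - βp) * (((1 - βm) * μ / σ ^ 3 + lm / σ) /
          (lp * ((1 - βm) * lp + (1 - βp) * lm)))
        + (1 - βm) * (2 - βm) * (((βp - 1) * μ / σ ^ 3 + lp / σ) /
          (lm * ((1 - βm) * lp + (1 - βp) * lm))) := by
  have hD : 0 < (1 - βm) * lp + (1 - βp) * lm := by
    have h1 : 0 < 1 - βm := by linarith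
    have h2 : 0 < 1 - βp := by linarith
    positivity
  set d := (1 - βm) * lp + (1 - βp) * lm with hd
  have e1 : (1 - βm) * μ / σ ^ 3 + lm / σ = a / lp * d / σ ^ 3 := by
    have : lm / σ = lm * σ ^ 2 / σ ^ 3 := by field_simp
    rw [this, hσ2, hμ, hd]
    field_simp
    ring
  have e2 : (βp - 1) * μ / σ ^ 3 + lp / σ = b / lm * d / σ ^ 3 := by
    have : lp / σ = lp * σ ^ 2 / σ ^ 3 := by field_simp
    rw [this, hσ2, hμ, hd]
    field_simp
    ring
  rw [e1, e2]
  clear_value d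
  field_simp

theorem mainTheorem1 :
    ∃ c : ℝ, IsLeast {C : ℝ | IsBerryEsseenBound C} c ∧
      ∀ (αp βp lp αm βm lm : ℝ),
        0 < αp → 0 ≤ βp → βp < 1 → 0 < lp →
        0 < αm → 0 ≤ βm → βm < 1 → 0 < lm →
        ∀ {Ω : Type*} [MeasurableSpace Ω] (P : Measure Ω) [IsProbabilityMeasure P] (X : Ω → ℝ),
          AEMeasurable X P → IsTS αp βp lp αm βm lm (P.map X) →
          MemLp X 2 P ∧ 0 < Var[X; P] ∧
          ∀ μ σ : ℝ, μ = ∫ ω, X ω ∂P → σ = √(Var[X; P]) →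
            (⨆ x : ℝ, |cdf (P.map X) x - cdf (gaussianReal μ (Real.toNNReal (σ ^ 2))) x|)
              ≤ 32 * c *
                ((1 - βp) * (2 - βp) *
                    (((1 - βm) * μ / σ ^ 3 + lm / σ) /
                      (lp * ((1 - βm) * lp + (1 - βp) * lm)))
                  + (1 - βm) * (2 - βm) *
                    (((βp - 1) * μ / σ ^ 3 + lp / σ) /
                      (lm * ((1 - βm) * lp + (1 - βp) * lm)))) := by
  obtain ⟨c, hc⟩ := exists_isLeast_isBerryEsseenBound
  refine ⟨c, hc, ?_⟩
  intro αp βp lp αm βm lm hαp _ hβp hlp hαm _ hβm hlm Ω _ P _ X hX hTS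
  obtain ⟨ηp, ηm, hp, hm, hη⟩ := hTS
  obtain ⟨h3, hmean, hvar, hmain⟩ := normal_approximation_of_isOneSidedTS hp hm hαp hβp hlp
    hαm hβm hlm
  rw [← hη] at h3 hmean hvar hmain
  have hXvar : Var[X; P] = Var[id; P.map X] := (variance_id_map hX).symm
  have hXmean : ∫ ω, X ω ∂P = ∫ x, x ∂(P.map X) :=
    (integral_map hX (f := fun x : ℝ => x) (by fun_prop)).symm
  have hX3 : MemLp X 3 P := (memLp_map_measure_iff (by fun_prop) hX).1 h3
  have pp := integral_pow_tsLevyMeasure_pos hαp hβp hlp one_le_two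
  have pm := integral_pow_tsLevyMeasure_pos hαm hβm hlm one_le_two
  have hpos : 0 < Var[X; P] := by rw [hXvar, hvar]; positivity
  refine ⟨hX3.mono_exponent (by norm_num), hpos, fun μ σ hμ hσ => ?_⟩
  have hσ0 : 0 < σ := hσ ▸ Real.sqrt_pos.2 hpos
  have hσ2 : σ ^ 2 = Var[id; P.map X] := by rw [hσ, Real.sq_sqrt hpos.le, hXvar]
  rw [hXmean] at hμ
  have hc0 : 0 ≤ c := hc.1.nonneg
  have p2 := integral_pow_succ_tsLevyMeasure hαp hβp hlp (le_refl 1)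
  have p3 := integral_pow_succ_tsLevyMeasure hαp hβp hlp one_le_two
  have m2 := integral_pow_succ_tsLevyMeasure hαm hβm hlm (le_refl 1)
  have m3 := integral_pow_succ_tsLevyMeasure hαm hβm hlm one_le_two
  norm_num only at p2 p3 m2 m3
  have k3p := integral_pow_tsLevyMeasure_pos hαp hβp hlp (by norm_num : 1 ≤ 3)
  have k3m := integral_pow_tsLevyMeasure_pos hαm hβm hlm (by norm_num : 1 ≤ 3)
  rw [← third_moment_eq_bracket (a := ∫ x, x ^ 1 ∂(tsLevyMeasure αp βp lp))
    (b := ∫ x, x ^ 1 ∂(tsLevyMeasure αm βm lm)) hβp hβm hlp hlm hσ0 (hμ.trans hmean)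
    (by rw [hσ2, hvar, p2, m2]), ← p2, ← p3, ← m2, ← m3]
  refine ciSup_le fun x => (hmain c hc.1 μ σ hμ hσ0 hσ2 x).trans ?_
  rw [mul_div_assoc]
  gcongr
  norm_num
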